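/- Let $\mathcal H$ be a separable infinite-dimensional complex Hilbert space. For $p\ge 1$ let $\mathcal L^p(\mathcal H)$ be the Schatten class with norm $\|T\|_p=\big(\sum_n s_n(T)^p\big)^{1/p}$, where $s_n(T)$ are the singular numbers of $T$, and let $\mathcal U_p(\mathcal H)$ be the set of unitaries $U$ on $\mathcal H$ with $U-\mathrm{Id}\in\mathcal L^p(\mathcal H)$. For $A\in\mathcal L^1(\mathcal H)$ let $\mathrm{Det}(\mathrm{Id}+A)=\lim_{N\to\infty}\det\big(\delta_{jk}+(h_j,Ah_k)\big)_{1\le j,k\le N}$ be the Fredholm determinant ($(h_n)$ any orthonormal basis of $\mathcal H$, on which the limit does not depend). For an integer $p\ge 1$ and $U\in\mathcal U_p(\mathcal H)$ let $$\mathrm{Det}_p(U)=\mathrm{Det}\Big(U\exp\Big(\sum_{\ell=1}^{p-1}\frac{(-1)^\ell}{\ell}(U-\mathrm{Id})^\ell\Big)\Big),$$ the operator inside $\mathrm{Det}$ being $\mathrm{Id}$ plus a trace-class operator. Let $p\ge 1$ be an integer and let $U_\bullet:[0,1]\to\mathcal U_p(\mathcal H)$ be a path which is differentiable in the norm $\|\cdot\|_p$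 on $(0,1)$, with derivative $U_t'$. Then for almost all $t\in[0,1]$ the function $t\mapsto \mathrm{Det}_p(U_t)$ is differentiable at $t$, $\mathrm{Det}_p(U_t)\neq 0$, the operator $U_t^*U_t'(U_t-\mathrm{Id})^{p-1}$ is trace class, and $$\frac{\frac{d}{dt}\mathrm{Det}_p(U_t)}{\mathrm{Det}_p(U_t)}=(-1)^{p-1}\,\mathrm{Tr}\big(U_t^*U_t'(U_t-\mathrm{Id})^{p-1}\big).$$ -/

import Mathlib

open Filter Topology MeasureTheory Set
open scoped ENNReal

noncomputable section

namespace SchattenUnitaries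

variable {H : Type*} [NormedAddCommGroup H] [InnerProductSpace ℂ H]

/-- The `n`-th singular number (`n = 0, 1, 2, …`) of a bounded operator `T` on a Hilbert space, i.e.
its distance in operator norm to the operators of rank at most `n`. For compact `T` these
are the eigenvalues of `|T|` in decreasing order, repeated according to multiplicity. -/
def singularNumber (T : H →L[ℂ] H) (n : ℕ) : ℝ≥0∞ :=
  ⨅ (F : H →L[ℂ] H) (_ : (F : H →ₗ[ℂ] H).rank ≤ (n : Cardinal)), ‖T - F‖ₑ

/-- The Schatten norm `‖T‖_p = (∑ₙ sₙ(T) ^ p) ^ (1 / p)`, with the value `∞` off the Schatten class. -/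
def schattenNorm (p : ℝ) (T : H →L[ℂ] H) : ℝ≥0∞ :=
  (∑' n, singularNumber T n ^ p) ^ (1 / p)

/-- The Schatten class `𝓛^p(H)`. -/
def schattenClass (H : Type*) [NormedAddCommGroup H] [InnerProductSpace ℂ H] (p : ℝ) :
    Set (H →L[ℂ] H) :=
  {T | schattenNorm p T < ∞}

/-- The set `𝓤_p(H)` of the unitaries `U` on `H` with `U - Id ∈ 𝓛^p(H)`. -/
def schattenUnitaries (H : Type*) [NormedAddCommGroup H] [InnerProductSpace ℂ H]
    [CompleteSpace H] (p : ℝ) : Set (H →L[ℂ] H) :=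
  {U | U ∈ unitary (H →L[ℂ] H) ∧ U - 1 ∈ schattenClass H p}

/-- `D` is the derivative at `t` of the operator-valued map `U`, in the norm `‖·‖_p`. -/
def HasSchattenDerivAt (p : ℝ) (U : ℝ → H →L[ℂ] H) (D : H →L[ℂ] H) (t : ℝ) : Prop :=
  D ∈ schattenClass H p ∧
    Tendsto (fun s : ℝ => schattenNorm p (((s - t : ℝ) : ℂ)⁻¹ • (U s - U t) - D))
      (𝓝[≠] t) (𝓝 0)

/-- `τ` is the sum `∑ₙ (hₙ, T hₙ)` for every orthonormal basis `(hₙ)` of `H`. -/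
def HasTrace (T : H →L[ℂ] H) (τ : ℂ) : Prop :=
  ∀ h : HilbertBasis ℕ ℂ H, HasSum (fun n => inner ℂ (h n) (T (h n))) τ

open Classical in
/-- The trace of an operator on a separable infinite-dimensional Hilbert space
(meaningful for trace-class operators; `0` where the defining sums fail to have a common value). -/
def trace (T : H →L[ℂ] H) : ℂ :=
  if hT : ∃ τ, HasTrace T τ then hT.choose else 0

/-- The matrix `M_N` with entries `δ_{jk} + (h_j, A h_k)`, `j, k < N`. -/
def truncation (h : HilbertBasis ℕ ℂ H) (A : H →L[ℂ] H) (N : ℕ) : Matrix (Fin N) (Fin N) ℂ :=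
  Matrix.of fun j k => (if j = k then 1 else 0) + inner ℂ (h j) (A (h k))

/-- `d` is the limit of `det M_N` as `N → ∞`, for every orthonormal basis of `H`. -/
def HasFredholmDet (A : H →L[ℂ] H) (d : ℂ) : Prop :=
  ∀ h : HilbertBasis ℕ ℂ H, Tendsto (fun N => (truncation h A N).det) atTop (𝓝 d)

open Classical in
/-- The Fredholm determinant `Det(Id + A)`, as a function of `A`, on a separable
infinite-dimensional Hilbert space (meaningful for trace-class `A`; `0` where the
defining limits fail to have a common value). -/
def fredholmDet (A : H →L[ℂ] H) : ℂ :=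
  if hA : ∃ d, HasFredholmDet A d then hA.choose else 0

/-- The operator `R = U exp(∑_{ℓ=1}^{p-1} ((-1)^ℓ / ℓ) (U - Id)^ℓ) - Id`. -/
def regularisation (p : ℕ) (U : H →L[ℂ] H) : H →L[ℂ] H :=
  U * NormedSpace.exp (∑ l ∈ Finset.Ico 1 p, ((-1 : ℂ) ^ l / (l : ℂ)) • (U - 1) ^ l) - 1

/-- The regularised determinant `Det_p(U)`, for `U - Id ∈ 𝓛^p(H)`. -/
def regDet (p : ℕ) (U : H →L[ℂ] H) : ℂ :=
  fredholmDet (regularisation p U)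

end SchattenUnitaries

end

/-! Put `A = U - 1`, `p = m + 1`, and let `q` be the Taylor polynomial of `-log (1 + X)` of degree
`m`. The regularised operator is `(1 + A) exp (q(A)) - 1`. As a scalar function this vanishes to
order `p` at `0`, so it equals `A ^ p * g(A)` with `g` entire (`exists_eq_pow_mul`). By Hölder's
inequality for Schatten norms, a difference quotient of the path converging in `‖·‖_p` yields a
difference quotient of `A ^ p * g(A)` converging in `‖·‖_1` (`SchattenTendsto.powDeriv`).

On trace-class operators the determinant is multiplicative and `Det(1 + K) = 1 + Tr K + O(‖K‖_1 ^
2)`. Together these give Jacobi's formula: the logarithmic derivative of `Det(1 + f)` is `Tr((1 +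
f)⁻¹ f')` (`hasDerivAt_fredholmDet`).

It remains to evaluate this trace. For a nuclear direction `B`, cyclicity of the trace lets
everything commute under it and leaves `Tr((V + q'(A)) B)` with `V = (1 + A)⁻¹`. Since `(1 + X) q' =
(-X) ^ m - 1`, one has `V + q'(A) = (-1) ^ m A ^ m V`, which is the claim
(`trace_deriv_of_nuclear`). For `B` merely in the `p`-class, `V B` and `q'(A) B` need not be trace
class separately. But both sides of the final identity are continuous in `B` for `‖·‖_p`, and
finite-rank operators are dense (`hasDerivAt_regDet`).

Trace-norm estimates are carried by nuclear representations (`HasNuclearBound`);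
`hasNuclearBound_of_schattenNorm_lt_top` connects them to singular numbers. Only convergence to zero
matters, so constants are not optimised. -/

set_option linter.unusedSectionVars false

noncomputable section

namespace SchattenUnitaries

/-! ### Nuclear operators and the trace. -/

section

variable {H : Type*} [NormedAddCommGroup H] [InnerProductSpace ℂ H]
  [CompleteSpace H]

/-- `T` is a sum of rank one operators `v ↦ ⟪yᵢ, v⟫ xᵢ` with `∑ ‖xᵢ‖ ‖yᵢ‖ ≤ c`. -/
def HasNuclearBound (T : H →L[ℂ] H) (c : ℝ) : Prop :=
  ∃ (ι : Type) (x y : ι → H), (Summable fun i => ‖x i‖ * ‖y i‖) ∧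
    ∑' i, ‖x i‖ * ‖y i‖ ≤ c ∧ ∀ v, HasSum (fun i => inner ℂ (y i) v • x i) (T v)

namespace HasNuclearBound

variable {S T : H →L[ℂ] H} {c d : ℝ}

theorem nonneg (hT : HasNuclearBound T c) : 0 ≤ c := by
  obtain ⟨ι, x, y, -, hc, -⟩ := hT
  exact (tsum_nonneg fun i => by positivity).trans hc

theorem mono (hT : HasNuclearBound T c) (h : c ≤ d) : HasNuclearBound T d := by
  obtain ⟨ι, x, y, hs, hc, hv⟩ := hT
  exact ⟨ι, x, y, hs, hc.trans h, hv⟩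

theorem norm_le (hT : HasNuclearBound T c) : ‖T‖ ≤ c := by
  have h0 := hT.nonneg
  obtain ⟨ι, x, y, hs, hc, hv⟩ := hT
  refine T.opNorm_le_bound h0 fun v => ?_
  have hb : ∀ i, ‖inner ℂ (y i) v • x i‖ ≤ ‖x i‖ * ‖y i‖ * ‖v‖ := fun i => by
    rw [norm_smul]
    nlinarith [norm_inner_le_norm (𝕜 := ℂ) (y i) v, norm_nonneg (x i)]
  rw [← (hv v).tsum_eq]
  refine (tsum_of_norm_bounded (hs.hasSum.mul_right ‖v‖) hb).trans ?_
  gcongr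

theorem rankOne (x y : H) (hT : ∀ v, T v = inner ℂ y v • x) :
    HasNuclearBound T (‖x‖ * ‖y‖) := by
  refine ⟨Unit, fun _ => x, fun _ => y, (hasSum_fintype _).summable, by simp, fun v => ?_⟩
  simp [hT v]

/-- Nuclear bounds are countably subadditive. -/
theorem of_hasSum {κ : Type} {R : κ → H →L[ℂ] H} {b : κ → ℝ} (hR : ∀ k, HasNuclearBound (R k) (b k))
    (hb : Summable b) (hT : ∀ v, HasSum (fun k => R k v) (T v)) :
    HasNuclearBound T (∑' k, b k) := by
  choose ι x y hs hc hv using hR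
  have hsum : Summable fun z : (k : κ) × ι k => ‖x z.1 z.2‖ * ‖y z.1 z.2‖ := by
    refine (summable_sigma_of_nonneg fun z => by positivity).2 ⟨hs, ?_⟩
    exact hb.of_nonneg_of_le (fun k => tsum_nonneg fun i => by positivity) hc
  refine ⟨(k : κ) × ι k, fun z => x z.1 z.2, fun z => y z.1 z.2, hsum, ?_, fun v => ?_⟩
  · rw [hsum.tsum_sigma]
    exact hsum.sigma.tsum_le_tsum hc hb
  · refine HasSum.sigma_of_hasSum (hT v) (fun k => hv k v) ?_
    refine Summable.of_norm_bounded (hsum.mul_right ‖v‖) fun z => ?_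
    rw [norm_smul]
    nlinarith [norm_inner_le_norm (𝕜 := ℂ) (y z.1 z.2) v, norm_nonneg (x z.1 z.2)]

theorem zero : HasNuclearBound (0 : H →L[ℂ] H) 0 := by
  simpa using! rankOne (T := (0 : H →L[ℂ] H)) 0 0 (by simp)

theorem sum {κ : Type} (s : Finset κ) {R : κ → H →L[ℂ] H} {b : κ → ℝ}
    (hR : ∀ k ∈ s, HasNuclearBound (R k) (b k)) :
    HasNuclearBound (∑ k ∈ s, R k) (∑ k ∈ s, b k) := by
  have := of_hasSum (T := ∑ k ∈ s, R k) (R := fun k : s => R k) (b := fun k : s => b k)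
    (fun k => hR k k.2) (hasSum_fintype _).summable fun v => by
      have := hasSum_fintype (fun k : s => R k v)
      rw [Finset.sum_coe_sort s fun k => R k v] at this
      simpa [sum_apply] using this
  rwa [tsum_fintype, Finset.sum_coe_sort s b] at this

theorem add (hS : HasNuclearBound S c) (hT : HasNuclearBound T d) :
    HasNuclearBound (S + T) (c + d) := by
  have := sum (Finset.univ : Finset Bool) (R := fun i => cond i S T) (b := fun i => cond i c d)
    (by rintro (_ | _) - <;> assumption)
  simpa using this

theorem mul_left (B : H →L[ℂ] H) (hT : HasNuclearBound T c) :
    HasNuclearBound (B * T) (‖B‖ * c) := by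
  obtain ⟨ι, x, y, hs, hc, hv⟩ := hT
  have hle : ∀ i, ‖B (x i)‖ * ‖y i‖ ≤ ‖B‖ * (‖x i‖ * ‖y i‖) := fun i => by
    rw [← mul_assoc]; gcongr; exact B.le_opNorm _
  have hs' := (hs.mul_left ‖B‖).of_nonneg_of_le (fun i => by positivity) hle
  refine ⟨ι, fun i => B (x i), y, hs', ?_, fun v => ?_⟩
  · refine (hs'.tsum_le_tsum hle (hs.mul_left _)).trans ?_
    rw [tsum_mul_left]; gcongr
  · simpa using (hv v).mapL B

theorem smul (a : ℂ) (hT : HasNuclearBound T c) : HasNuclearBound (a • T) (‖a‖ * c) := by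
  have := hT.mul_left (a • 1)
  rw [smul_one_mul] at this
  refine this.mono (mul_le_mul_of_nonneg_right ?_ hT.nonneg)
  rw [norm_smul]
  exact mul_le_of_le_one_right (norm_nonneg a) ContinuousLinearMap.norm_id_le

theorem neg (hT : HasNuclearBound T c) : HasNuclearBound (-T) c := by
  simpa using hT.smul (-1)

theorem mul_right (hT : HasNuclearBound T c) (B : H →L[ℂ] H) :
    HasNuclearBound (T * B) (c * ‖B‖) := by
  obtain ⟨ι, x, y, hs, hc, hv⟩ := hT
  have hle : ∀ i, ‖x i‖ * ‖B.adjoint (y i)‖ ≤ (‖x i‖ * ‖y i‖) * ‖B‖ := fun i => by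
    rw [mul_assoc]; gcongr
    have := B.adjoint.le_opNorm (y i)
    rwa [LinearIsometryEquiv.norm_map, mul_comm] at this
  have hs' := (hs.mul_right ‖B‖).of_nonneg_of_le (fun i => by positivity) hle
  refine ⟨ι, x, fun i => B.adjoint (y i), hs', ?_, fun v => ?_⟩
  · refine (hs'.tsum_le_tsum hle (hs.mul_right _)).trans ?_
    rw [tsum_mul_right]; gcongr
  · simpa [ContinuousLinearMap.adjoint_inner_left] using hv (B v)

/-- An operator of rank at most `n` is nuclear, with bound `n ‖T‖`. -/
theorem of_rank_le {n : ℕ} (hT : (T : H →ₗ[ℂ] H).rank ≤ (n : Cardinal)) :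
    HasNuclearBound T (n * ‖T‖) := by
  let V := LinearMap.range (T : H →ₗ[ℂ] H)
  have hV : Module.rank ℂ V ≤ (n : Cardinal) := hT
  have : FiniteDimensional ℂ V :=
    Module.rank_lt_aleph0_iff.1 (hV.trans_lt (Cardinal.natCast_lt_aleph0))
  have hn : Module.finrank ℂ V ≤ n := Module.finrank_le_of_rank_le hV
  let e := stdOrthonormalBasis ℂ V
  have he : ∀ i, ‖(e i : H)‖ = 1 := fun i => e.orthonormal.1 i
  have hb : ∀ i, ‖T.adjoint (e i)‖ ≤ ‖T‖ := fun i => by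
    have := T.adjoint.le_opNorm (e i)
    rwa [LinearIsometryEquiv.norm_map, he, mul_one] at this
  -- Expand `T v` in an orthonormal basis of the range; the coefficients are `⟪e i, T v⟫ = ⟪T* (e
  -- i), v⟫`.
  refine ⟨Fin (Module.finrank ℂ V), fun i => e i, fun i => T.adjoint (e i),
    (hasSum_fintype _).summable, ?_, fun v => ?_⟩
  · rw [tsum_fintype]
    calc _ ≤ ∑ i : Fin (Module.finrank ℂ V), ‖T‖ := Finset.sum_le_sum fun i _ => by
          rw [he, one_mul]; exact hb i
      _ ≤ _ := by
          simp only [Finset.sum_const, Finset.card_univ, Fintype.card_fin, nsmul_eq_mul]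
          gcongr
  · have h1 := e.sum_repr' ⟨T v, LinearMap.mem_range_self _ v⟩
    have h2 := congrArg (Subtype.val) h1
    rw [AddSubmonoidClass.coe_finsetSum] at h2
    have h3 := hasSum_fintype
      (fun i => inner ℂ (T.adjoint (e i : H)) v • (e i : H))
    convert h3 using 1
    refine h2.symm.trans ?_
    refine Finset.sum_congr rfl fun i _ => ?_
    rw [ContinuousLinearMap.adjoint_inner_left]
    rfl

end HasNuclearBound

/-- Cauchy–Schwarz followed by Bessel. The bound is uniform in `s`, which makes the double series
for the trace absolutely convergent. -/
theorem sum_norm_inner_mul_inner_le {κ : Type*} {h : κ → H} (hh : Orthonormal ℂ h) (s : Finset κ)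
    (x y : H) : ∑ n ∈ s, ‖inner ℂ y (h n) * inner ℂ (h n) x‖ ≤ ‖x‖ * ‖y‖ := by
  have hx := hh.sum_inner_products_le x (s := s)
  have hy := hh.sum_inner_products_le y (s := s)
  calc _ = ∑ n ∈ s, ‖inner ℂ (h n) x‖ * ‖inner ℂ (h n) y‖ :=
        Finset.sum_congr rfl fun n _ => by rw [norm_mul, mul_comm, norm_inner_symm y]
    _ ≤ √(∑ n ∈ s, ‖inner ℂ (h n) x‖ ^ 2) * √(∑ n ∈ s, ‖inner ℂ (h n) y‖ ^ 2) :=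
        Real.sum_mul_le_sqrt_mul_sqrt _ _ _
    _ ≤ √(‖x‖ ^ 2) * √(‖y‖ ^ 2) := by gcongr
    _ = _ := by rw [Real.sqrt_sq (norm_nonneg _), Real.sqrt_sq (norm_nonneg _)]

/-- Summing over the basis first, Parseval gives `⟪y i, x i⟫` for each `i`, a value free of the
basis. Absolute convergence permits the exchange of sums. -/
theorem hasTrace_of_nuclear {T : H →L[ℂ] H} {ι : Type} {x y : ι → H}
    (hs : Summable fun i => ‖x i‖ * ‖y i‖)
    (hv : ∀ v, HasSum (fun i => inner ℂ (y i) v • x i) (T v)) :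
    HasTrace T (∑' i, inner ℂ (y i) (x i)) := by
  intro h
  have hsi : ∀ i, Summable fun n => ‖inner ℂ (y i) (h n) * inner ℂ (h n) (x i)‖ := fun i =>
    summable_of_sum_le (fun _ => norm_nonneg _)
      fun s => sum_norm_inner_mul_inner_le h.orthonormal s (x i) (y i)
  have hsum : Summable fun z : ι × ℕ => inner ℂ (y z.1) (h z.2) * inner ℂ (h z.2) (x z.1) := by
    refine Summable.of_norm ((summable_prod_of_nonneg fun z => norm_nonneg _).2 ⟨hsi, ?_⟩)
    refine hs.of_nonneg_of_le (fun i => tsum_nonneg fun n => norm_nonneg _) fun i => ?_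
    exact (hsi i).tsum_le_of_sum_le
      fun s => sum_norm_inner_mul_inner_le h.orthonormal s (x i) (y i)
  have hsw : HasSum (fun z : ℕ × ι => inner ℂ (y z.2) (h z.1) * inner ℂ (h z.1) (x z.2))
      (∑' i, inner ℂ (y i) (x i)) := by
    refine ((Equiv.prodComm ι ℕ).hasSum_iff).1 ?_
    have h1 := hsum.hasSum
    have h2 := hsum.hasSum.prod_fiberwise fun i => h.hasSum_inner_mul_inner (y i) (x i)
    rw [← h2.tsum_eq] at h1
    exact h1
  refine hsw.prod_fiberwise fun n => ?_
  have := (hv (h n)).mapL (innerSL ℂ (h n))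
  simpa [inner_smul_right] using this

theorem HasNuclearBound.norm_sum_inner_le {T : H →L[ℂ] H} {c : ℝ} (hT : HasNuclearBound T c)
    {κ : Type*} {h : κ → H} (hh : Orthonormal ℂ h) (s : Finset κ) :
    ‖∑ n ∈ s, inner ℂ (h n) (T (h n))‖ ≤ c := by
  obtain ⟨ι, x, y, hs, hc, hv⟩ := hT
  have h1 : HasSum (fun i => ∑ n ∈ s, inner ℂ (y i) (h n) * inner ℂ (h n) (x i))
      (∑ n ∈ s, inner ℂ (h n) (T (h n))) := by
    refine hasSum_sum fun n _ => ?_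
    have := (hv (h n)).mapL (innerSL ℂ (h n))
    simpa [inner_smul_right] using this
  rw [← h1.tsum_eq]
  refine (tsum_of_norm_bounded hs.hasSum fun i => ?_).trans hc
  exact (norm_sum_le _ _).trans (sum_norm_inner_mul_inner_le hh s _ _)

theorem HasTrace.add {S T : H →L[ℂ] H} {σ τ : ℂ} (hS : HasTrace S σ) (hT : HasTrace T τ) :
    HasTrace (S + T) (σ + τ) := fun h => by
  simpa [inner_add_right] using (hS h).add (hT h)

theorem HasTrace.smul {T : H →L[ℂ] H} {τ : ℂ} (a : ℂ) (hT : HasTrace T τ) :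
    HasTrace (a • T) (a * τ) := fun h => by
  simpa [inner_smul_right] using (hT h).mul_left a

theorem HasNuclearBound.exists_hasTrace {T : H →L[ℂ] H} {c : ℝ} (hT : HasNuclearBound T c) :
    ∃ τ, HasTrace T τ := by
  obtain ⟨ι, x, y, hs, -, hv⟩ := hT
  exact ⟨_, hasTrace_of_nuclear hs hv⟩

variable [Nonempty (HilbertBasis ℕ ℂ H)]

/-- A basis indexed by `ℕ` must exist here: otherwise `HasTrace` holds vacuously for every value. -/
theorem HasTrace.trace_eq {T : H →L[ℂ] H} {τ : ℂ} (hT : HasTrace T τ) : trace T = τ := by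
  have hex : ∃ τ, HasTrace T τ := ⟨τ, hT⟩
  obtain ⟨h⟩ := ‹Nonempty (HilbertBasis ℕ ℂ H)›
  rw [trace, dif_pos hex]
  exact (hex.choose_spec h).unique (hT h)

namespace HasNuclearBound

variable {S T : H →L[ℂ] H} {c d : ℝ}

theorem hasTrace (hT : HasNuclearBound T c) : HasTrace T (trace T) := by
  obtain ⟨τ, hτ⟩ := hT.exists_hasTrace
  rwa [hτ.trace_eq]

theorem norm_trace_le (hT : HasNuclearBound T c) : ‖trace T‖ ≤ c := by
  obtain ⟨h⟩ := ‹Nonempty (HilbertBasis ℕ ℂ H)›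
  exact le_of_tendsto (hT.hasTrace h).norm
    (Eventually.of_forall fun s => hT.norm_sum_inner_le h.orthonormal s)

theorem trace_add (hS : HasNuclearBound S c) (hT : HasNuclearBound T d) :
    trace (S + T) = trace S + trace T :=
  (hS.hasTrace.add hT.hasTrace).trace_eq

theorem trace_smul (a : ℂ) (hT : HasNuclearBound T c) : trace (a • T) = a * trace T :=
  (hT.hasTrace.smul a).trace_eq

theorem trace_sub (hS : HasNuclearBound S c) (hT : HasNuclearBound T d) :
    trace (S - T) = trace S - trace T := by
  have := hS.trace_add (hT.smul (-1))
  rw [hT.trace_smul] at this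
  simpa [sub_eq_add_neg] using this

theorem trace_sum {κ : Type} (s : Finset κ) {R : κ → H →L[ℂ] H} {b : κ → ℝ}
    (hR : ∀ k ∈ s, HasNuclearBound (R k) (b k)) :
    trace (∑ k ∈ s, R k) = ∑ k ∈ s, trace (R k) := by
  refine HasTrace.trace_eq fun h => ?_
  have := hasSum_sum fun k hk => (hR k hk).hasTrace h
  simpa [sum_apply, inner_sum] using this

/-- The trace is countably additive. -/
theorem hasSum_trace {κ : Type} {R : κ → H →L[ℂ] H} {b : κ → ℝ}
    (hR : ∀ k, HasNuclearBound (R k) (b k))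
    (hb : Summable b) (hT : ∀ v, HasSum (fun k => R k v) (T v)) :
    HasSum (fun k => trace (R k)) (trace T) := by
  have hb0 : ∀ k, 0 ≤ b k := fun k => (hR k).nonneg
  rw [HasSum, SummationFilter.unconditional_filter, tendsto_iff_norm_sub_tendsto_zero]
  refine squeeze_zero (fun _ => norm_nonneg _) (fun s => ?_) (tendsto_tsum_compl_atTop_zero b)
  -- The remainder is the sum of the omitted terms, so its trace is at most a tail of `∑ b k`.
  have h1 : HasNuclearBound (T - ∑ k ∈ s, R k) (∑' k : {k // k ∉ s}, b k) := by
    refine of_hasSum (κ := {k // k ∉ s}) (R := fun k => R k) (fun k => hR k) (hb.subtype _)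
      fun v => ?_
    have h2 := (Finset.hasSum_compl_iff s (f := fun k => R k v)
      (a := T v - ∑ k ∈ s, R k v)).2 (by simpa using hT v)
    simpa [sum_apply] using h2
  have h3 := (of_hasSum hR hb hT).trace_sub (sum s fun k _ => hR k)
  rw [norm_sub_rev, ← trace_sum s fun k _ => hR k, ← h3]
  exact h1.norm_trace_le

/-- Both traces equal `∑ ⟪y i, B (x i)⟫`. -/
theorem trace_mul_comm (hT : HasNuclearBound T c) (B : H →L[ℂ] H) :
    trace (B * T) = trace (T * B) := by
  obtain ⟨ι, x, y, hs, -, hv⟩ := hT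
  have h1 : HasTrace (B * T) (∑' i, inner ℂ (y i) (B (x i))) := by
    refine hasTrace_of_nuclear ?_ fun v => by simpa using (hv v).mapL B
    refine (hs.mul_left ‖B‖).of_nonneg_of_le (fun i => by positivity) fun i => ?_
    rw [← mul_assoc]; gcongr; exact B.le_opNorm _
  have h2 : HasTrace (T * B) (∑' i, inner ℂ (B.adjoint (y i)) (x i)) := by
    refine hasTrace_of_nuclear ?_ fun v => by
      simpa [ContinuousLinearMap.adjoint_inner_left] using hv (B v)
    refine (hs.mul_right ‖B‖).of_nonneg_of_le (fun i => by positivity) fun i => ?_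
    rw [mul_assoc]; gcongr
    have := B.adjoint.le_opNorm (y i)
    rwa [LinearIsometryEquiv.norm_map, mul_comm] at this
  rw [h1.trace_eq, h2.trace_eq]
  simp [ContinuousLinearMap.adjoint_inner_left]

end HasNuclearBound

end

/-! ### Fredholm determinants of nuclear operators. -/

section

variable {H : Type*} [NormedAddCommGroup H] [InnerProductSpace ℂ H] [CompleteSpace H]

-- The left side is the product of the eigenvalues `λ` of `(1 + M)ᴴ (1 + M)`; use `λ ≤ exp (λ - 1)`
-- and compute `∑ (λ - 1)` as a trace.
open Matrix in
open scoped ComplexOrder in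
theorem _root_.Matrix.norm_det_one_add_sq_le {n : Type*} [Fintype n] [DecidableEq n]
    (M : Matrix n n ℂ) :
    ‖(1 + M).det‖ ^ 2 ≤ Real.exp (2 * M.trace.re + ∑ i, ∑ j, ‖M i j‖ ^ 2) := by
  have hB : ((1 + M)ᴴ * (1 + M)).PosSemidef := posSemidef_conjTranspose_mul_self _
  have hdet : ((‖(1 + M).det‖ ^ 2 : ℝ) : ℂ) = ((∏ i, hB.1.eigenvalues i : ℝ) : ℂ) := by
    have := hB.1.det_eq_prod_eigenvalues
    rw [det_mul, det_conjTranspose] at this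
    push_cast
    rw [← Complex.conj_mul']
    exact this
  have htr : ∑ i, (hB.1.eigenvalues i - 1) = 2 * M.trace.re + ∑ i, ∑ j, ‖M i j‖ ^ 2 := by
    have h1 := congrArg Complex.re hB.1.trace_eq_sum_eigenvalues
    generalize hB.1.eigenvalues = E at h1 ⊢
    have h2 : ((1 + M)ᴴ * (1 + M)).trace
        = Fintype.card n + M.trace + star M.trace + (Mᴴ * M).trace := by
      rw [conjTranspose_add, add_mul, mul_add, mul_add]
      simp only [trace_add, conjTranspose_one, one_mul, mul_one, trace_one, trace_conjTranspose]
      ring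
    have h3 : (Mᴴ * M).trace.re = ∑ i, ∑ j, ‖M i j‖ ^ 2 := by
      simp only [Matrix.trace, diag_apply, mul_apply, conjTranspose_apply, Complex.re_sum]
      rw [Finset.sum_comm]
      refine Finset.sum_congr rfl fun i _ => Finset.sum_congr rfl fun j _ => ?_
      have := Complex.conj_mul' (M i j)
      rw [← Complex.ofReal_pow] at this
      exact congrArg Complex.re this
    rw [h2] at h1
    simp only [Complex.add_re, Complex.star_def, Complex.conj_re, h3, Complex.natCast_re,
      Complex.re_sum, Complex.coe_algebraMap, Complex.ofReal_re] at h1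
    rw [Finset.sum_sub_distrib]
    simp only [Finset.sum_const, Finset.card_univ, nsmul_eq_mul, mul_one]
    linarith
  rw [Complex.ofReal_inj.1 hdet, ← htr, Real.exp_sum]
  refine Finset.prod_le_prod (fun i _ => hB.eigenvalues_nonneg i) fun i _ => ?_
  linarith [Real.add_one_le_exp (hB.1.eigenvalues i - 1)]

/-- The matrix of `A` with respect to the first `N` vectors of a basis. -/
def compression (h : HilbertBasis ℕ ℂ H) (A : H →L[ℂ] H) (N : ℕ) : Matrix (Fin N) (Fin N) ℂ :=
  Matrix.of fun j k => inner ℂ (h j) (A (h k))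

theorem compression_apply (h : HilbertBasis ℕ ℂ H) (A : H →L[ℂ] H) {N : ℕ} (j k : Fin N) :
    compression h A N j k = inner ℂ (h j) (A (h k)) := rfl

theorem truncation_eq (h : HilbertBasis ℕ ℂ H) (A : H →L[ℂ] H) (N : ℕ) :
    truncation h A N = 1 + compression h A N := by
  ext j k
  simp [truncation, compression, Matrix.one_apply]

theorem compression_add (h : HilbertBasis ℕ ℂ H) (A B : H →L[ℂ] H) (N : ℕ) :
    compression h (A + B) N = compression h A N + compression h B N := by
  ext j k; simp [compression]

theorem compression_smul (h : HilbertBasis ℕ ℂ H) (z : ℂ) (A : H →L[ℂ] H) (N : ℕ) :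
    compression h (z • A) N = z • compression h A N := by
  ext j k; simp [compression]

theorem trace_compression (h : HilbertBasis ℕ ℂ H) (A : H →L[ℂ] H) (N : ℕ) :
    (compression h A N).trace = ∑ n ∈ Finset.range N, inner ℂ (h n) (A (h n)) := by
  rw [Finset.sum_range]; rfl

/-- The point is uniformity in `N` and in the basis. The Hilbert–Schmidt term is at most a partial
trace of `A* A`, hence at most `‖A‖ c ≤ c ^ 2`. -/
theorem HasNuclearBound.norm_det_truncation_le {A : H →L[ℂ] H} {c : ℝ} (hA : HasNuclearBound A c)
    (h : HilbertBasis ℕ ℂ H) (N : ℕ) : ‖(truncation h A N).det‖ ≤ Real.exp (c + c ^ 2) := by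
  have hc := hA.nonneg
  rw [truncation_eq]
  refine abs_le_of_sq_le_sq' ?_ (Real.exp_pos _).le |>.2
  refine (Matrix.norm_det_one_add_sq_le _).trans ?_
  rw [← Real.exp_nat_mul, Real.exp_le_exp]
  have h1 : (compression h A N).trace.re ≤ c := by
    rw [trace_compression]
    exact (Complex.re_le_norm _).trans (hA.norm_sum_inner_le h.orthonormal _)
  have h2 : ∑ i, ∑ j, ‖compression h A N i j‖ ^ 2 ≤ c * c := by
    have h3 := ((hA.mul_left A.adjoint).norm_sum_inner_le h.orthonormal (Finset.range N)).trans
      (mul_le_mul_of_nonneg_right ((LinearIsometryEquiv.norm_map _ A).trans_le hA.norm_le) hc)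
    refine le_trans ?_ h3
    rw [Finset.sum_comm]
    have h4 : ∀ k, inner ℂ (h k) ((A.adjoint * A) (h k)) = ((‖A (h k)‖ ^ 2 : ℝ) : ℂ) := fun k => by
      rw [mul_apply_eq_comp, ContinuousLinearMap.adjoint_inner_right,
        inner_self_eq_norm_sq_to_K]
      simp
    simp only [h4]
    rw [← Complex.ofReal_sum, Complex.norm_real, Real.norm_of_nonneg (by positivity),
      Finset.sum_range]
    refine Finset.sum_le_sum fun k _ => ?_
    simp only [compression_apply]
    rw [← Finset.sum_range fun j => ‖inner ℂ (h j) (A (h k))‖ ^ 2]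
    exact h.orthonormal.sum_inner_products_le _
  push_cast
  nlinarith

theorem differentiable_det_add_smul {n : Type*} [Fintype n] [DecidableEq n] (A B : Matrix n n ℂ) :
    Differentiable ℂ fun z : ℂ => (A + z • B).det := by
  simp only [Matrix.det_apply, Matrix.add_apply, Matrix.smul_apply, smul_eq_mul]
  fun_prop

/-- Schwarz lemma for the holomorphic function sending `z` to the determinant for `A + z K`: on the
disc `|z| < 1 / k` the nuclear bound stays below `a + 1`. Evaluating at `z = 1` produces the factor
`k`. -/
theorem HasNuclearBound.norm_det_truncation_sub_le {A K : H →L[ℂ] H} {a k : ℝ}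
    (hA : HasNuclearBound A a) (hK : HasNuclearBound K k) (hk : 0 < k) (hk1 : k < 1)
    (h : HilbertBasis ℕ ℂ H) (N : ℕ) :
    ‖(truncation h (A + K) N).det - (truncation h A N).det‖ ≤
      k * (2 * Real.exp ((a + 1) + (a + 1) ^ 2) + 1) := by
  have ha := hA.nonneg
  set M := Real.exp ((a + 1) + (a + 1) ^ 2)
  let f : ℂ → ℂ := fun z => (truncation h A N + z • compression h K N).det
  have hf : ∀ z : ℂ, f z = (truncation h (A + z • K) N).det := fun z => by
    simp only [f, truncation_eq, compression_add, compression_smul, add_assoc]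
  have hb : ∀ z ∈ Metric.ball (0 : ℂ) k⁻¹, ‖f z‖ ≤ M := fun z hz => by
    rw [hf]
    refine ((hA.add (hK.smul z)).mono ?_).norm_det_truncation_le h N
    rw [mem_ball_zero_iff] at hz
    have := mul_le_mul_of_nonneg_right hz.le hk.le
    rw [inv_mul_cancel₀ hk.ne'] at this
    linarith
  have h0 : (0 : ℂ) ∈ Metric.ball (0 : ℂ) k⁻¹ := Metric.mem_ball_self (inv_pos.2 hk)
  have h1 : (1 : ℂ) ∈ Metric.ball (0 : ℂ) k⁻¹ := by
    rw [mem_ball_zero_iff, norm_one]; exact (one_lt_inv₀ hk).2 hk1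
  have := Complex.dist_le_div_mul_dist_of_mapsTo_ball (f := f) (c := 0) (R₁ := k⁻¹)
    (R₂ := 2 * M + 1) (differentiable_det_add_smul _ _).differentiableOn (fun z hz => ?_) h1
  · rw [dist_eq_norm, hf, hf, one_smul, zero_smul, add_zero, dist_zero_right, norm_one, mul_one,
      div_inv_eq_mul, mul_comm] at this
    exact this
  · rw [Metric.mem_closedBall, dist_eq_norm]
    linarith [norm_sub_le (f z) (f 0), hb z hz, hb 0 h0]

/-- Sylvester's identity `det (1 + X Y) = det (1 + Y X)` moves the determinant to the fixed size
`κ`, where the entries converge by Parseval. -/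
theorem hasFredholmDet_of_finite {κ : Type*} [Fintype κ] [DecidableEq κ] (x y : κ → H)
    (A : H →L[ℂ] H) (hA : ∀ v, A v = ∑ i, inner ℂ (y i) v • x i) :
    HasFredholmDet A (1 + Matrix.of fun i j => inner ℂ (y i) (x j)).det := by
  intro h
  let X (N : ℕ) : Matrix (Fin N) κ ℂ := Matrix.of fun j i => inner ℂ (h j) (x i)
  let Y (N : ℕ) : Matrix κ (Fin N) ℂ := Matrix.of fun i k => inner ℂ (y i) (h k)
  have h1 : ∀ N, (truncation h A N).det = (1 + Y N * X N).det := fun N => by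
    rw [truncation_eq, ← Matrix.det_one_add_mul_comm (X N)]
    congr 2
    ext j k
    simp [compression, X, Y, hA, Matrix.mul_apply, mul_comm]
  simp only [h1]
  have h2 : Tendsto (fun N => 1 + Y N * X N) atTop
      (𝓝 (1 + Matrix.of fun i j => inner ℂ (y i) (x j))) := by
    refine tendsto_const_nhds.add ?_
    refine tendsto_pi_nhds.2 fun i => tendsto_pi_nhds.2 fun j => ?_
    have := (h.hasSum_inner_mul_inner (y i) (x j)).tendsto_sum_nat
    simpa [Matrix.mul_apply, X, Y, Finset.sum_range] using! this
  exact (Continuous.matrix_det continuous_id).continuousAt.tendsto.comp h2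

theorem HasNuclearBound.exists_finite_approx {A : H →L[ℂ] H} {c k : ℝ} (hA : HasNuclearBound A c)
    (hk : 0 < k) : ∃ (F : H →L[ℂ] H) (d : ℂ), HasFredholmDet F d ∧ HasNuclearBound (F - A) k := by
  classical
  obtain ⟨ι, x, y, hs, -, hv⟩ := hA
  obtain ⟨s, hsk⟩ := ((tendsto_tsum_compl_atTop_zero fun i => ‖x i‖ * ‖y i‖).eventually
    (gt_mem_nhds hk)).exists
  let R : ι → H →L[ℂ] H := fun i => (innerSL ℂ (y i)).smulRight (x i)
  refine ⟨∑ i ∈ s, R i, _, hasFredholmDet_of_finite (fun i : s => x i) (fun i : s => y i) _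
    fun v => ?_, ?_⟩
  · rw [Finset.sum_coe_sort s fun i => inner ℂ (y i) v • x i]
    simp [R, sum_apply]
  · rw [← neg_sub]
    refine HasNuclearBound.neg ⟨{i // i ∉ s}, fun i => x i, fun i => y i, hs.subtype _, hsk.le,
      fun v => ?_⟩
    have h2 := (Finset.hasSum_compl_iff s (f := fun i => inner ℂ (y i) v • x i)
      (a := A v - ∑ i ∈ s, R i v)).2 (by simpa [R] using hv v)
    simpa [sum_apply] using h2

/-- Finite-rank approximations change the truncated determinants by an amount uniform in `N`, so the
two limits can be exchanged. The values `d n` do not depend on the basis, hence neither does their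
limit. -/
theorem HasNuclearBound.exists_hasFredholmDet {A : H →L[ℂ] H} {c : ℝ} (hA : HasNuclearBound A c)
    [Nonempty (HilbertBasis ℕ ℂ H)] : ∃ d, HasFredholmDet A d := by
  -- The extra factor `1 / 2` keeps the bound strictly below `1` at `n = 0`.
  have hpos : ∀ n : ℕ, (0 : ℝ) < 1 / ((n : ℝ) + 1) / 2 := fun n => by positivity
  choose F d hF hk using fun n => hA.exists_finite_approx (hpos n)
  set M := 2 * Real.exp ((c + 1) + (c + 1) ^ 2) + 1
  let e : ℕ → ℝ := fun n => 1 / ((n : ℝ) + 1) / 2 * M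
  have he : Tendsto e atTop (𝓝 0) := by
    simpa only [zero_div, zero_mul] using
      ((tendsto_one_div_add_atTop_nhds_zero_nat (𝕜 := ℝ)).div_const 2).mul_const M
  have hle : ∀ (h : HilbertBasis ℕ ℂ H) n N,
      ‖(truncation h (F n) N).det - (truncation h A N).det‖ ≤ e n := fun h n N => by
    have h1 := hA.norm_det_truncation_sub_le (hk n) (hpos n) ?_ h N
    · rwa [add_sub_cancel] at h1
    · have : 1 / ((n : ℝ) + 1) ≤ 1 := by
        rw [div_le_one (by positivity)]; linarith [Nat.cast_nonneg (α := ℝ) n]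
      linarith
  obtain ⟨h₀⟩ := ‹Nonempty (HilbertBasis ℕ ℂ H)›
  have hcau : CauchySeq d := by
    refine Metric.cauchySeq_iff'.2 fun ε hε => ?_
    obtain ⟨n₀, hn₀⟩ := (eventually_atTop).1 (he.eventually (gt_mem_nhds (half_pos hε)))
    refine ⟨n₀, fun n hn => ?_⟩
    have h1 : ‖d n - d n₀‖ ≤ e n + e n₀ := by
      refine le_of_tendsto ((hF n h₀).sub (hF n₀ h₀)).norm (Eventually.of_forall fun N => ?_)
      have h2 := norm_sub_le_norm_sub_add_norm_sub (truncation h₀ (F n) N).det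
        (truncation h₀ A N).det (truncation h₀ (F n₀) N).det
      rw [norm_sub_rev (truncation h₀ A N).det] at h2
      exact h2.trans (add_le_add (hle h₀ n N) (hle h₀ n₀ N))
    rw [dist_eq_norm]
    linarith [hn₀ n hn, hn₀ n₀ le_rfl]
  obtain ⟨ℓ, hℓ⟩ := cauchySeq_tendsto_of_complete hcau
  refine ⟨ℓ, fun h => ?_⟩
  refine TendstoUniformlyOnFilter.tendsto_of_eventually_tendsto
    (F := fun n N => (truncation h (F n) N).det) (p := atTop) (L := d) ?_
    (Eventually.of_forall fun n => hF n h) hℓ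
  refine Metric.tendstoUniformlyOnFilter_iff.2 fun ε hε => ?_
  have := (he.eventually (gt_mem_nhds hε)).prod_inl (atTop : Filter ℕ)
  filter_upwards [this] with z hz
  rw [dist_comm, dist_eq_norm]
  exact (hle h z.1 z.2).trans_lt hz

section Projection

/-- The orthogonal projection onto the span of the first `N` vectors of a basis. -/
def basisProj (h : HilbertBasis ℕ ℂ H) (N : ℕ) : H →L[ℂ] H :=
  ∑ k ∈ Finset.range N, (innerSL ℂ (h k)).smulRight (h k)

theorem basisProj_apply (h : HilbertBasis ℕ ℂ H) (N : ℕ) (v : H) :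
    basisProj h N v = ∑ k ∈ Finset.range N, inner ℂ (h k) v • h k := by
  simp [basisProj, sum_apply]

theorem tendsto_basisProj (h : HilbertBasis ℕ ℂ H) (v : H) :
    Tendsto (fun N => basisProj h N v) atTop (𝓝 v) := by
  have := (h.hasSum_repr v).tendsto_sum_nat
  simpa [basisProj_apply, h.repr_apply_apply] using! this

theorem inner_basisProj (h : HilbertBasis ℕ ℂ H) (N : ℕ) (v w : H) :
    inner ℂ v (basisProj h N w) = inner ℂ (basisProj h N v) w := by
  simp only [basisProj_apply, inner_sum, sum_inner, inner_smul_left, inner_smul_right,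
    inner_conj_symm]
  exact Finset.sum_congr rfl fun k _ => mul_comm _ _

theorem norm_basisProj_le (h : HilbertBasis ℕ ℂ H) (N : ℕ) : ‖basisProj h N‖ ≤ 1 := by
  refine ContinuousLinearMap.opNorm_le_bound _ zero_le_one fun v => ?_
  rw [one_mul]
  have h1 : ‖basisProj h N v‖ ^ 2 ≤ ‖v‖ ^ 2 := by
    refine le_trans (le_of_eq ?_) (h.orthonormal.sum_inner_products_le v (s := Finset.range N))
    have h2 : inner ℂ (basisProj h N v) (basisProj h N v)
        = ((∑ k ∈ Finset.range N, ‖inner ℂ (h k) v‖ ^ 2 : ℝ) : ℂ) := by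
      rw [basisProj_apply, h.orthonormal.inner_sum]
      push_cast
      exact Finset.sum_congr rfl fun k _ => Complex.conj_mul' _
    rw [inner_self_eq_norm_sq_to_K] at h2
    exact Complex.ofReal_injective (by rw [← h2]; simp)
  exact abs_le_of_sq_le_sq' h1 (norm_nonneg _) |>.2

theorem norm_one_sub_basisProj_le (h : HilbertBasis ℕ ℂ H) (N : ℕ) :
    ‖1 - basisProj h N‖ ≤ 2 := by
  have h1 : ‖(1 : H →L[ℂ] H)‖ ≤ 1 := ContinuousLinearMap.norm_id_le
  linarith [norm_sub_le 1 (basisProj h N), norm_basisProj_le h N]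

/-- The self-adjoint factor `1 - P_N` moves onto the vectors `y i`, where strong convergence
suffices by dominated convergence. -/
theorem HasNuclearBound.exists_tendsto_basisProj {A : H →L[ℂ] H} {c : ℝ} (hA : HasNuclearBound A c)
    (h : HilbertBasis ℕ ℂ H) (B : H →L[ℂ] H) : ∃ e : ℕ → ℝ, Tendsto e atTop (𝓝 0) ∧
      ∀ N, HasNuclearBound (A * (1 - basisProj h N) * B) (e N) := by
  obtain ⟨ι, x, y, hs, -, hv⟩ := hA
  have hle : ∀ N i, ‖x i‖ * ‖B.adjoint ((1 - basisProj h N) (y i))‖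
      ≤ ‖x i‖ * ‖y i‖ * (2 * ‖B‖) := fun N i => by
    have h1 := B.adjoint.le_opNorm ((1 - basisProj h N) (y i))
    rw [LinearIsometryEquiv.norm_map] at h1
    have h2 := (1 - basisProj h N).le_opNorm (y i)
    have h3 := norm_one_sub_basisProj_le h N
    calc _ ≤ ‖x i‖ * (‖B‖ * (2 * ‖y i‖)) := by
          gcongr
          exact h1.trans (by gcongr; exact h2.trans (by gcongr))
      _ = _ := by ring
  refine ⟨fun N => ∑' i, ‖x i‖ * ‖B.adjoint ((1 - basisProj h N) (y i))‖, ?_, fun N => ?_⟩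
  · rw [← tsum_zero (β := ι)]
    refine tendsto_tsum_of_dominated_convergence (hs.mul_right (2 * ‖B‖)) (fun i => ?_)
      (Eventually.of_forall fun N i => ?_)
    · have h1 : Tendsto (fun N => (1 - basisProj h N) (y i)) atTop (𝓝 0) := by
        simpa using (tendsto_const_nhds (x := y i)).sub (tendsto_basisProj h (y i))
      have h2 := ((B.adjoint.continuous.tendsto 0).comp h1).norm.const_mul ‖x i‖
      simpa using h2
    · rw [Real.norm_of_nonneg (by positivity)]
      exact hle N i
  · refine ⟨ι, x, fun i => B.adjoint ((1 - basisProj h N) (y i)),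
      (hs.mul_right (2 * ‖B‖)).of_nonneg_of_le (fun i => by positivity) (hle N), le_rfl,
      fun v => ?_⟩
    have := hv ((1 - basisProj h N) (B v))
    simpa [ContinuousLinearMap.adjoint_inner_left, inner_sub_left, inner_sub_right,
      inner_basisProj] using this

end Projection

/-- Compression is multiplicative only with the projection inserted; the defect `A (1 - P_N) B` is
what `fredholmDet_mul` must make negligible. -/
theorem truncation_mul_truncation (h : HilbertBasis ℕ ℂ H) (A B : H →L[ℂ] H) (N : ℕ) :
    truncation h A N * truncation h B N = truncation h (A + B + A * basisProj h N * B) N := by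
  rw [truncation_eq, truncation_eq, truncation_eq, compression_add, compression_add, add_mul,
    mul_add, mul_add, one_mul, mul_one, one_mul]
  have : compression h A N * compression h B N = compression h (A * basisProj h N * B) N := by
    ext j k
    simp [compression, Matrix.mul_apply, basisProj_apply,
      Finset.sum_range, mul_comm]
  rw [this]; abel

variable [Nonempty (HilbertBasis ℕ ℂ H)]

theorem HasFredholmDet.fredholmDet_eq {A : H →L[ℂ] H} {d : ℂ} (hA : HasFredholmDet A d) :
    fredholmDet A = d := by
  have hex : ∃ d, HasFredholmDet A d := ⟨d, hA⟩
  obtain ⟨h⟩ := ‹Nonempty (HilbertBasis ℕ ℂ H)›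
  rw [fredholmDet, dif_pos hex]
  exact tendsto_nhds_unique (hex.choose_spec h) (hA h)

theorem fredholmDet_zero : fredholmDet (0 : H →L[ℂ] H) = 1 := by
  refine HasFredholmDet.fredholmDet_eq fun h => ?_
  have : ∀ N, compression h 0 N = 0 := fun N => by ext; simp [compression]
  simp [truncation_eq, this]

namespace HasNuclearBound

variable {A B : H →L[ℂ] H} {a b : ℝ}

theorem hasFredholmDet (hA : HasNuclearBound A a) : HasFredholmDet A (fredholmDet A) := by
  obtain ⟨d, hd⟩ := hA.exists_hasFredholmDet
  rwa [hd.fredholmDet_eq]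

theorem fredholmDet_mul (hA : HasNuclearBound A a) (hB : HasNuclearBound B b) :
    fredholmDet (A + B + A * B) = fredholmDet A * fredholmDet B := by
  have hAB := (hA.add hB).add (hA.mul_right B)
  obtain ⟨h⟩ := ‹Nonempty (HilbertBasis ℕ ℂ H)›
  obtain ⟨e, he, hPe⟩ := hA.exists_tendsto_basisProj h B
  have h1 := (hA.hasFredholmDet h).mul (hB.hasFredholmDet h)
  have h2 := hAB.hasFredholmDet h
  refine tendsto_nhds_unique h2 ?_
  -- Adding `1 / (N + 1)` makes the perturbation bound strictly positive, as
  -- `norm_det_truncation_sub_le` demands.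
  refine (tendsto_iff_of_dist (squeeze_zero' (Eventually.of_forall fun _ => dist_nonneg)
    (g := fun N => (e N + 1 / ((N : ℝ) + 1)) *
      (2 * Real.exp (((a + b + a * ‖B‖) + 1) + ((a + b + a * ‖B‖) + 1) ^ 2) + 1)) ?_ ?_)).1 h1
  · have he' : Tendsto (fun N : ℕ => e N + 1 / ((N : ℝ) + 1)) atTop (𝓝 0) := by
      simpa using he.add tendsto_one_div_add_atTop_nhds_zero_nat
    filter_upwards [he'.eventually (gt_mem_nhds one_pos)] with N hN
    have h3 := hAB.norm_det_truncation_sub_le (K := -(A * (1 - basisProj h N) * B)) ?_ ?_ hN h N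
    · have h4 : A + B + A * B + -(A * (1 - basisProj h N) * B) = A + B + A * basisProj h N * B := by
        noncomm_ring
      rwa [dist_eq_norm, ← Matrix.det_mul, truncation_mul_truncation, ← h4]
    · have : (0 : ℝ) ≤ 1 / ((N : ℝ) + 1) := by positivity
      exact (hPe N).neg.mono (by linarith)
    · have : (0 : ℝ) < 1 / ((N : ℝ) + 1) := by positivity
      linarith [(hPe N).nonneg]
  · simpa using (he.add tendsto_one_div_add_atTop_nhds_zero_nat).mul_const
      (2 * Real.exp (((a + b + a * ‖B‖) + 1) + ((a + b + a * ‖B‖) + 1) ^ 2) + 1)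

/-- `Det(Id + A) = 1 + Tr A + O(c²)`, where `c ≤ 1` is a nuclear bound of `A`. -/
theorem norm_fredholmDet_sub_le (hA : HasNuclearBound A a) (ha : 0 < a) (ha1 : a ≤ 1) :
    ‖fredholmDet A - 1 - trace A‖ ≤ (Real.exp 2 + 2) * a ^ 2 := by
  obtain ⟨h⟩ := ‹Nonempty (HilbertBasis ℕ ℂ H)›
  have h1 : Tendsto (fun N => ‖(truncation h A N).det - 1 - (compression h A N).trace‖) atTop
      (𝓝 ‖fredholmDet A - 1 - trace A‖) := by
    simp only [trace_compression]
    exact (((hA.hasFredholmDet h).sub_const 1).sub (hA.hasTrace h).tendsto_sum_nat).norm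
  refine le_of_tendsto h1 (Eventually.of_forall fun N => ?_)
  set M := compression h ((a⁻¹ : ℂ) • A) N
  have hAa : HasNuclearBound ((a⁻¹ : ℂ) • A) 1 := by
    refine (hA.smul (a⁻¹ : ℂ)).mono (le_of_eq ?_)
    rw [norm_inv, Complex.norm_real, Real.norm_of_nonneg ha.le, inv_mul_cancel₀ ha.ne']
  -- `Q` is the quotient by `z ^ 2` of the remainder beyond first order of `det (1 + z M)`, with `M`
  -- rescaled to nuclear bound `1`. The maximum principle bounds it on the unit disc by its size on
  -- the circle, at most `exp (1 + 1 ^ 2) + 1 + 1`.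
  let Q := (Matrix.det (1 + (Polynomial.X : Polynomial ℂ) • M.map Polynomial.C)).divX.divX
  have hQ : ∀ z : ℂ, (1 + z • M).det = 1 + M.trace * z + Q.eval z * z ^ 2 :=
    fun z => Matrix.det_one_add_smul z M
  have hMtr : ‖M.trace‖ ≤ 1 := by
    rw [trace_compression]; exact hAa.norm_sum_inner_le h.orthonormal _
  have hQle : ∀ z ∈ closure (Metric.ball (0 : ℂ) 1), ‖Q.eval z‖ ≤ Real.exp 2 + 2 := fun z hz => by
    refine Complex.norm_le_of_forall_mem_frontier_norm_le Metric.isBounded_ball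
      (Q.differentiable.diffContOnCl) (fun w hw => ?_) hz
    rw [frontier_ball _ one_ne_zero, mem_sphere_zero_iff_norm] at hw
    have h2 : ‖(1 + w • M).det‖ ≤ Real.exp 2 := by
      have h3 := ((hAa.smul w).mono (d := 1) (by rw [hw, one_mul])).norm_det_truncation_le h N
      rw [truncation_eq, compression_smul] at h3
      norm_num at h3
      exact h3
    have h4 : Q.eval w * w ^ 2 = (1 + w • M).det - 1 - M.trace * w := by rw [hQ]; ring
    have h5 := congrArg norm h4
    rw [norm_mul, norm_pow, hw, one_pow, mul_one] at h5
    rw [h5]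
    have h6 : ‖M.trace * w‖ ≤ 1 := by rw [norm_mul, hw, mul_one]; exact hMtr
    have h7 := norm_sub_le ((1 + w • M).det - 1) (M.trace * w)
    have h8 := norm_sub_le (1 + w • M).det 1
    rw [norm_one] at h8
    linarith
  have haM : compression h A N = (a : ℂ) • M := by
    rw [← compression_smul, smul_smul, mul_inv_cancel₀ (by exact_mod_cast ha.ne'), one_smul]
  rw [truncation_eq, haM, hQ, Matrix.trace_smul, smul_eq_mul]
  have h9 : 1 + M.trace * a + Q.eval (a : ℂ) * a ^ 2 - 1 - a * M.trace = Q.eval (a : ℂ) * a ^ 2 := by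
    ring
  rw [h9, norm_mul, norm_pow, Complex.norm_real, Real.norm_of_nonneg ha.le]
  gcongr
  refine hQle _ ?_
  rw [closure_ball _ one_ne_zero, mem_closedBall_zero_iff, Complex.norm_real,
    Real.norm_of_nonneg ha.le]
  exact ha1

end HasNuclearBound

end

/-! ### Singular numbers, Schatten norms and Hölder's inequality. -/

section

variable {H : Type*} [NormedAddCommGroup H] [InnerProductSpace ℂ H] [CompleteSpace H]

section SingularNumbers

variable (S T : H →L[ℂ] H)

theorem singularNumber_eq_iInf (n : ℕ) : singularNumber T n =
    ⨅ F : {F : H →L[ℂ] H // (F : H →ₗ[ℂ] H).rank ≤ (n : Cardinal)}, ‖T - F‖ₑ := by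
  rw [singularNumber, iInf_subtype']

variable {T} in
theorem singularNumber_le {F : H →L[ℂ] H} {n : ℕ} (hF : (F : H →ₗ[ℂ] H).rank ≤ (n : Cardinal)) :
    singularNumber T n ≤ ‖T - F‖ₑ := iInf₂_le F hF

theorem rank_zero_le (n : ℕ) : ((0 : H →L[ℂ] H) : H →ₗ[ℂ] H).rank ≤ (n : Cardinal) := by
  rw [ContinuousLinearMap.toLinearMap_zero, LinearMap.rank_zero]; exact zero_le

theorem singularNumber_le_enorm (n : ℕ) : singularNumber T n ≤ ‖T‖ₑ := by
  simpa using singularNumber_le (T := T) (rank_zero_le n)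

theorem singularNumber_zero : singularNumber T 0 = ‖T‖ₑ := by
  refine le_antisymm (singularNumber_le_enorm T 0) (le_iInf₂ fun F hF => ?_)
  have h1 : (F : H →ₗ[ℂ] H).rank = 0 := by simpa using hF
  have h2 : F = 0 := by
    rw [LinearMap.rank, Submodule.rank_eq_zero, LinearMap.range_eq_bot] at h1
    exact ContinuousLinearMap.coe_injective h1
  simp [h2]

theorem singularNumber_ne_top (n : ℕ) : singularNumber T n ≠ ∞ :=
  ((singularNumber_le_enorm T n).trans_lt enorm_lt_top).ne

theorem singularNumber_antitone : Antitone (singularNumber T) := fun _ _ h =>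
  le_iInf₂ fun _ hF => singularNumber_le (hF.trans (Nat.cast_le.2 h))

theorem singularNumber_add_le (m n : ℕ) :
    singularNumber (S + T) (m + n) ≤ singularNumber S m + singularNumber T n := by
  refine ENNReal.le_iInf₂_add_iInf₂ fun F hF G hG => ?_
  have hFG : ((F + G : H →L[ℂ] H) : H →ₗ[ℂ] H).rank ≤ ((m + n : ℕ) : Cardinal) := by
    rw [ContinuousLinearMap.toLinearMap_add]
    push_cast
    exact (LinearMap.rank_add_le _ _).trans (add_le_add hF hG)
  refine (singularNumber_le hFG).trans ?_
  rw [add_sub_add_comm]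
  exact enorm_add_le _ _

theorem enorm_mul_le (S T : H →L[ℂ] H) : ‖S * T‖ₑ ≤ ‖S‖ₑ * ‖T‖ₑ := by
  simp only [enorm, ← ENNReal.coe_mul, ENNReal.coe_le_coe]
  exact nnnorm_mul_le S T

/-- If `F`, `G` approximate `S`, `T`, then `F T + (S - F) G` has rank at most `m + n` and error `(S
- F) (T - G)`. -/
theorem singularNumber_mul_le (m n : ℕ) :
    singularNumber (S * T) (m + n) ≤ singularNumber S m * singularNumber T n := by
  rw [singularNumber_eq_iInf S, singularNumber_eq_iInf T]
  refine ENNReal.le_iInf_mul_iInf ⟨⟨0, rank_zero_le m⟩, enorm_ne_top⟩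
    ⟨⟨0, rank_zero_le n⟩, enorm_ne_top⟩ fun F G => ?_
  have hFG : ((F * T + (S - F) * G : H →L[ℂ] H) : H →ₗ[ℂ] H).rank ≤ ((m + n : ℕ) : Cardinal) := by
    rw [ContinuousLinearMap.toLinearMap_add]
    push_cast
    exact (LinearMap.rank_add_le _ _).trans (add_le_add
      ((LinearMap.rank_comp_le_left _ _).trans F.2) ((LinearMap.rank_comp_le_right _ _).trans G.2))
  refine (singularNumber_le hFG).trans ?_
  have : S * T - (F * T + (S - F) * G) = (S - F) * (T - G) := by noncomm_ring
  rw [this]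
  exact enorm_mul_le _ _

theorem singularNumber_mul_le_right (n : ℕ) :
    singularNumber (S * T) n ≤ singularNumber S n * ‖T‖ₑ := by
  simpa [singularNumber_zero] using singularNumber_mul_le S T n 0

theorem singularNumber_mul_le_left (n : ℕ) :
    singularNumber (S * T) n ≤ ‖S‖ₑ * singularNumber T n := by
  simpa [singularNumber_zero] using singularNumber_mul_le S T 0 n

end SingularNumbers

/-- Singular numbers of sums and products are controlled at index `n + n`; passing to all indices
costs a factor `2`. -/
theorem tsum_le_two_mul_tsum_even {f : ℕ → ℝ≥0∞} (hf : Antitone f) :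
    ∑' n, f n ≤ 2 * ∑' n, f (2 * n) := by
  rw [← tsum_even_add_odd ENNReal.summable ENNReal.summable, two_mul]
  gcongr
  exact hf (by omega)

section SchattenNorm

variable {r : ℝ} {S T : H →L[ℂ] H}

theorem schattenNorm_le_of_singularNumber_le (hr : 0 < r) {c : ℝ≥0∞}
    (h : ∀ n, singularNumber S n ≤ c * singularNumber T n) :
    schattenNorm r S ≤ c * schattenNorm r T := by
  have h1 : (c ^ r) ^ (1 / r) = c := by
    rw [← ENNReal.rpow_mul, mul_one_div_cancel hr.ne', ENNReal.rpow_one]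
  conv_rhs => rw [schattenNorm, ← h1, ← ENNReal.mul_rpow_of_nonneg _ _ (by positivity),
    ← ENNReal.tsum_mul_left]
  refine ENNReal.rpow_le_rpow (ENNReal.tsum_le_tsum fun n => ?_) (by positivity)
  rw [← ENNReal.mul_rpow_of_nonneg _ _ hr.le]
  exact ENNReal.rpow_le_rpow (h n) hr.le

theorem schattenNorm_mul_le_left (hr : 0 < r) :
    schattenNorm r (S * T) ≤ ‖S‖ₑ * schattenNorm r T :=
  schattenNorm_le_of_singularNumber_le hr (singularNumber_mul_le_left S T)

theorem schattenNorm_mul_le_right (hr : 0 < r) :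
    schattenNorm r (S * T) ≤ ‖T‖ₑ * schattenNorm r S :=
  schattenNorm_le_of_singularNumber_le hr fun n =>
    (singularNumber_mul_le_right S T n).trans_eq (mul_comm _ _)

theorem enorm_le_schattenNorm (hr : 0 < r) : ‖T‖ₑ ≤ schattenNorm r T := by
  have h1 : (‖T‖ₑ ^ r) ^ (1 / r) = ‖T‖ₑ := by
    rw [← ENNReal.rpow_mul, mul_one_div_cancel hr.ne', ENNReal.rpow_one]
  rw [← h1, schattenNorm, ← singularNumber_zero]
  exact ENNReal.rpow_le_rpow (ENNReal.le_tsum 0) (by positivity)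

/-- A bound of the doubled singular numbers controls the Schatten norm. -/
theorem schattenNorm_le_two_mul (hr : 1 ≤ r) {f : ℕ → ℝ≥0∞}
    (h : ∀ n, singularNumber T (2 * n) ≤ f n) :
    schattenNorm r T ≤ 2 * (∑' n, f n ^ r) ^ (1 / r) := by
  have hr0 : 0 < r := zero_lt_one.trans_le hr
  have h1 : ∑' n, singularNumber T n ^ r ≤ 2 * ∑' n, f n ^ r := by
    refine (tsum_le_two_mul_tsum_even fun m n hmn =>
      ENNReal.rpow_le_rpow (singularNumber_antitone T hmn) hr0.le).trans ?_
    gcongr with n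
    exact h n
  refine (ENNReal.rpow_le_rpow h1 (by positivity)).trans ?_
  rw [ENNReal.mul_rpow_of_nonneg _ _ (by positivity)]
  gcongr
  calc (2 : ℝ≥0∞) ^ (1 / r) ≤ 2 ^ (1 : ℝ) :=
        ENNReal.rpow_le_rpow_of_exponent_le (by norm_num) (by rw [div_le_one hr0]; exact hr)
    _ = 2 := ENNReal.rpow_one 2

theorem schattenNorm_add_le (hr : 1 ≤ r) :
    schattenNorm r (S + T) ≤ 2 * (schattenNorm r S + schattenNorm r T) := by
  refine (schattenNorm_le_two_mul (f := fun n => singularNumber S n + singularNumber T n) hr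
    fun n => ?_).trans (mul_le_mul_right ?_ 2)
  · rw [two_mul]; exact singularNumber_add_le S T n n
  · have := ENNReal.lintegral_Lp_add_le (μ := Measure.count) (p := r)
      (f := singularNumber S) (g := singularNumber T) (by fun_prop) (by fun_prop) hr
    simpa only [lintegral_count, Pi.add_apply, schattenNorm] using this

theorem schattenNorm_mul_le {q r s : ℝ} (hr : 1 ≤ r) (hrq : r < q) (h : 1 / r = 1 / q + 1 / s) :
    schattenNorm r (S * T) ≤ 2 * (schattenNorm q S * schattenNorm s T) := by
  refine (schattenNorm_le_two_mul (f := fun n => singularNumber S n * singularNumber T n) hr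
    fun n => ?_).trans (mul_le_mul_right ?_ 2)
  · rw [two_mul]; exact singularNumber_mul_le S T n n
  · have := ENNReal.lintegral_Lp_mul_le_Lq_mul_Lr (zero_lt_one.trans_le hr) hrq h Measure.count
      (f := singularNumber S) (g := singularNumber T) (by fun_prop) (by fun_prop)
    simpa only [lintegral_count, Pi.mul_apply, schattenNorm] using this

end SchattenNorm

/-- The norm `‖·‖_{p/k}`, where `p/0` stands for the operator norm. -/
def schattenQuotNorm (p k : ℕ) (T : H →L[ℂ] H) : ℝ≥0∞ :=
  if k = 0 then ‖T‖ₑ else schattenNorm ((p : ℝ) / k) T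

section SchattenQuotNorm

variable {p k : ℕ} {S T : H →L[ℂ] H}

theorem schattenQuotNorm_one : schattenQuotNorm p 1 T = schattenNorm p T := by
  simp [schattenQuotNorm]

theorem schattenQuotNorm_self (hp : 1 ≤ p) : schattenQuotNorm p p T = schattenNorm 1 T := by
  have : (p : ℝ) ≠ 0 := by positivity
  rw [schattenQuotNorm, if_neg (by omega), div_self this]

theorem one_le_div_of_le (hk : k ≠ 0) (hkp : k ≤ p) : (1 : ℝ) ≤ (p : ℝ) / k := by
  rw [one_le_div (by positivity)]; exact_mod_cast hkp

theorem schattenQuotNorm_add_le (hkp : k ≤ p) : schattenQuotNorm p k (S + T) ≤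
    2 * (schattenQuotNorm p k S + schattenQuotNorm p k T) := by
  unfold schattenQuotNorm
  split_ifs with hk
  · exact (enorm_add_le _ _).trans (le_mul_of_one_le_left zero_le (by norm_num))
  · exact schattenNorm_add_le (one_le_div_of_le hk hkp)

theorem schattenQuotNorm_mul_le_left (hkp : k ≤ p) :
    schattenQuotNorm p k (S * T) ≤ ‖S‖ₑ * schattenQuotNorm p k T := by
  unfold schattenQuotNorm
  split_ifs with hk
  · exact enorm_mul_le _ _
  · exact schattenNorm_mul_le_left (zero_lt_one.trans_le (one_le_div_of_le hk hkp))

theorem schattenQuotNorm_mul_le_right (hkp : k ≤ p) :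
    schattenQuotNorm p k (S * T) ≤ ‖T‖ₑ * schattenQuotNorm p k S := by
  unfold schattenQuotNorm
  split_ifs with hk
  · exact (enorm_mul_le _ _).trans_eq (mul_comm _ _)
  · exact schattenNorm_mul_le_right (zero_lt_one.trans_le (one_le_div_of_le hk hkp))

/-- Hölder with `(k + 1) / p = k / p + 1 / p`. Iterated, it puts a word with `p` factors from the
`p`-class into the trace class. -/
theorem schattenQuotNorm_mul_le (hkp : k + 1 ≤ p) : schattenQuotNorm p (k + 1) (S * T) ≤
    2 * (schattenQuotNorm p k S * schattenQuotNorm p 1 T) := by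
  have hp : (0 : ℝ) < p := by exact_mod_cast (by omega : 0 < p)
  rcases Nat.eq_zero_or_pos k with rfl | hk
  · refine (schattenQuotNorm_mul_le_left hkp).trans ?_
    rw [schattenQuotNorm.eq_def p 0, if_pos rfl]
    exact le_mul_of_one_le_left zero_le (by norm_num)
  · have hk' : (0 : ℝ) < k := by exact_mod_cast hk
    rw [schattenQuotNorm_one, schattenQuotNorm, schattenQuotNorm, if_neg (by omega),
      if_neg (by omega)]
    refine schattenNorm_mul_le (one_le_div_of_le (by omega) hkp) ?_ ?_
    · push_cast; gcongr; linarith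
    · push_cast; field_simp

theorem schattenQuotNorm_zero (hkp : k ≤ p) : schattenQuotNorm p k (0 : H →L[ℂ] H) = 0 := by
  have h := schattenQuotNorm_mul_le_left (S := 0) (T := (0 : H →L[ℂ] H)) hkp
  simpa using h

variable {α : Type*} {l : Filter α} {f g : α → H →L[ℂ] H}

/-- Convergence in `‖·‖_{p/k}` to a limit of finite norm. -/
def SchattenTendsto (p k : ℕ) (f : α → H →L[ℂ] H) (l : Filter α) (S : H →L[ℂ] H) : Prop :=
  schattenQuotNorm p k S < ∞ ∧ Tendsto (fun a => schattenQuotNorm p k (f a - S)) l (𝓝 0)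

namespace SchattenTendsto

theorem const (hkp : k ≤ p) (hS : schattenQuotNorm p k S < ∞) :
    SchattenTendsto p k (fun _ => S) l S := by
  refine ⟨hS, ?_⟩
  simp only [sub_self, schattenQuotNorm_zero hkp]
  exact tendsto_const_nhds

theorem add (hkp : k ≤ p) (hf : SchattenTendsto p k f l S) (hg : SchattenTendsto p k g l T) :
    SchattenTendsto p k (fun a => f a + g a) l (S + T) := by
  refine ⟨(schattenQuotNorm_add_le hkp).trans_lt
    (ENNReal.mul_lt_top (by norm_num) (ENNReal.add_lt_top.2 ⟨hf.1, hg.1⟩)), ?_⟩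
  have h1 := ENNReal.Tendsto.const_mul (hf.2.add hg.2) (a := 2) (Or.inr (by norm_num))
  rw [add_zero, mul_zero] at h1
  refine tendsto_of_tendsto_of_tendsto_of_le_of_le tendsto_const_nhds h1 (fun _ => zero_le)
    fun a => ?_
  rw [add_sub_add_comm]
  exact schattenQuotNorm_add_le hkp

theorem sum (hkp : k ≤ p) {κ : Type*} (s : Finset κ) {f : κ → α → H →L[ℂ] H} {S : κ → H →L[ℂ] H}
    (hf : ∀ i ∈ s, SchattenTendsto p k (f i) l (S i)) :
    SchattenTendsto p k (fun a => ∑ i ∈ s, f i a) l (∑ i ∈ s, S i) := by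
  classical
  induction s using Finset.induction_on with
  | empty =>
    simpa using const (l := l) (S := (0 : H →L[ℂ] H)) hkp (by simp [schattenQuotNorm_zero hkp])
  | insert i s hi ih =>
    simp only [Finset.sum_insert hi]
    exact (hf i (by simp)).add hkp (ih fun j hj => hf j (by simp [hj]))

/-- A product estimate for three norms gives convergence of products. -/
theorem mul_of_le {k j i : ℕ} (hkp : k ≤ p) (hf : SchattenTendsto p i f l S)
    (hg : SchattenTendsto p j g l T)
    (h : ∀ A B : H →L[ℂ] H, schattenQuotNorm p k (A * B) ≤
      2 * (schattenQuotNorm p i A * schattenQuotNorm p j B)) :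
    SchattenTendsto p k (fun a => f a * g a) l (S * T) := by
  refine ⟨(h S T).trans_lt (ENNReal.mul_lt_top (by norm_num) (ENNReal.mul_lt_top hf.1 hg.1)), ?_⟩
  have h1 := ENNReal.Tendsto.mul hf.2 (Or.inr ENNReal.zero_ne_top) hg.2
    (Or.inr ENNReal.zero_ne_top)
  have h2 := ENNReal.Tendsto.mul_const hf.2 (b := schattenQuotNorm p j T) (Or.inr hg.1.ne)
  have h3 := ENNReal.Tendsto.const_mul hg.2 (a := schattenQuotNorm p i S) (Or.inr hf.1.ne)
  have two : ∀ {u : α → ℝ≥0∞}, Tendsto u l (𝓝 0) → Tendsto (fun a => 2 * u a) l (𝓝 0) :=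
    fun hu => by simpa using ENNReal.Tendsto.const_mul hu (a := 2) (Or.inr (by norm_num))
  rw [zero_mul] at h1 h2
  rw [mul_zero] at h3
  have h4 := (two h1).add (two h2)
  rw [add_zero] at h4
  have h5 := (two h4).add (two h3)
  rw [add_zero] at h5
  refine tendsto_of_tendsto_of_tendsto_of_le_of_le tendsto_const_nhds (two h5)
    (fun _ => zero_le) fun a => ?_
  have : f a * g a - S * T = ((f a - S) * (g a - T) + (f a - S) * T) + S * (g a - T) := by
    noncomm_ring
  rw [this]
  refine (schattenQuotNorm_add_le hkp).trans ?_
  gcongr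
  · refine (schattenQuotNorm_add_le hkp).trans ?_
    gcongr <;> exact h _ _
  · exact h _ _

theorem mul (hkp : k + 1 ≤ p) (hf : SchattenTendsto p k f l S) (hg : SchattenTendsto p 1 g l T) :
    SchattenTendsto p (k + 1) (fun a => f a * g a) l (S * T) :=
  mul_of_le hkp hf hg fun _ _ => schattenQuotNorm_mul_le hkp

theorem of_tendsto (hf : Tendsto f l (𝓝 S)) : SchattenTendsto p 0 f l S := by
  simp only [SchattenTendsto, schattenQuotNorm, if_true]
  exact ⟨enorm_lt_top, by
    simpa only [edist_eq_enorm_sub] using tendsto_iff_edist_tendsto_0.1 hf⟩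

theorem tendsto (hkp : k ≤ p) (hf : SchattenTendsto p k f l S) : Tendsto f l (𝓝 S) := by
  rw [tendsto_iff_edist_tendsto_0]
  refine tendsto_of_tendsto_of_tendsto_of_le_of_le tendsto_const_nhds hf.2 (fun _ => zero_le)
    fun a => ?_
  rw [edist_eq_enorm_sub]
  unfold schattenQuotNorm
  split_ifs with hk
  · exact le_rfl
  · exact enorm_le_schattenNorm (zero_lt_one.trans_le (one_le_div_of_le hk hkp))

theorem mul_tendsto (hkp : k ≤ p) (hf : SchattenTendsto p k f l S) (hg : Tendsto g l (𝓝 T)) :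
    SchattenTendsto p k (fun a => f a * g a) l (S * T) :=
  mul_of_le hkp hf (of_tendsto hg) fun A B => by
    refine (schattenQuotNorm_mul_le_right hkp).trans ?_
    rw [mul_comm, schattenQuotNorm.eq_def p 0, if_pos rfl]
    exact le_mul_of_one_le_left zero_le (by norm_num)

theorem tendsto_mul (hkp : k ≤ p) (hf : Tendsto f l (𝓝 S)) (hg : SchattenTendsto p k g l T) :
    SchattenTendsto p k (fun a => f a * g a) l (S * T) :=
  mul_of_le hkp (of_tendsto hf) hg fun A B => by
    refine (schattenQuotNorm_mul_le_left hkp).trans ?_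
    rw [schattenQuotNorm.eq_def p 0, if_pos rfl]
    exact le_mul_of_one_le_left zero_le (by norm_num)

theorem pow (hf : SchattenTendsto p 1 f l S) : ∀ {k : ℕ}, k ≤ p →
    SchattenTendsto p k (fun a => f a ^ k) l (S ^ k)
  | 0, _ => by simpa using of_tendsto tendsto_const_nhds
  | k + 1, hk => by
    simp only [pow_succ]
    exact (pow hf (by omega)).mul hk hf

theorem mul_pow {k : ℕ} (hf : SchattenTendsto p k f l S) (hg : SchattenTendsto p 1 g l T) :
    ∀ {j : ℕ}, k + j ≤ p → SchattenTendsto p (k + j) (fun a => f a * g a ^ j) l (S * T ^ j)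
  | 0, _ => by simpa using hf
  | j + 1, hk => by
    simp only [pow_succ, ← mul_assoc, ← add_assoc]
    exact (mul_pow hf hg (by omega)).mul hk hg

end SchattenTendsto

end SchattenQuotNorm

/-! ### Trace class implies nuclear; density of finite-rank operators. -/

section Nuclear

/-- The dyadic finite-rank approximations of an operator with summable singular numbers. -/
theorem exists_rank_le_enorm_sub_le (T : H →L[ℂ] H) (hT : T ≠ 0) (k : ℕ) :
    ∃ F : H →L[ℂ] H, (F : H →ₗ[ℂ] H).rank ≤ ((2 ^ k : ℕ) : Cardinal) ∧
      ‖T - F‖ₑ ≤ singularNumber T (2 ^ k) + ‖T‖ₑ / 4 ^ k ∧ (k = 0 → F = 0) := by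
  rcases Nat.eq_zero_or_pos k with rfl | hk
  · refine ⟨0, rank_zero_le _, ?_, fun _ => rfl⟩
    simp
  · have h1 : singularNumber T (2 ^ k) < singularNumber T (2 ^ k) + ‖T‖ₑ / 4 ^ k :=
      ENNReal.lt_add_right (singularNumber_ne_top _ _)
        (ENNReal.div_pos (by simpa using hT) (by finiteness)).ne'
    rw [singularNumber_eq_iInf, iInf_lt_iff] at h1
    obtain ⟨F, hF⟩ := h1
    exact ⟨F, F.2, by rw [singularNumber_eq_iInf]; exact hF.le, fun h => by omega⟩

/-- Cauchy condensation contributes `1 + 2` multiples of the norm and the geometric slack `2` more.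
-/
theorem tsum_two_pow_mul_le (T : H →L[ℂ] H) :
    ∑' k : ℕ, 2 ^ k * (singularNumber T (2 ^ k) + ‖T‖ₑ / 4 ^ k) ≤ 6 * schattenNorm 1 T := by
  have hN : schattenNorm 1 T = ∑' n, singularNumber T n := by simp [schattenNorm]
  have h1 := ENNReal.tsum_condensed_le (f := singularNumber T)
    fun m n _ h => singularNumber_antitone T h
  have h2 : ∑' k : ℕ, (2 : ℝ≥0∞) ^ k * (‖T‖ₑ / 4 ^ k) = 2 * ‖T‖ₑ := by
    have h3 : ∀ k : ℕ, (2 : ℝ≥0∞) ^ k * (‖T‖ₑ / 4 ^ k) = ‖T‖ₑ * (2⁻¹) ^ k := fun k => by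
      have h4 : (4 : ℝ≥0∞) ^ k = 2 ^ k * 2 ^ k := by rw [← mul_pow]; norm_num
      have h5 : (2 : ℝ≥0∞) ^ k ≠ 0 := by positivity
      have h6 : (2 : ℝ≥0∞) ^ k ≠ ∞ := by finiteness
      rw [h4, div_eq_mul_inv, ENNReal.mul_inv (Or.inl h5) (Or.inl h6),
        mul_left_comm, ← mul_assoc (2 ^ k), ENNReal.mul_inv_cancel h5 h6, one_mul,
        ENNReal.inv_pow]
    simp_rw [h3]
    rw [ENNReal.tsum_mul_left, ENNReal.tsum_geometric, ENNReal.one_sub_inv_two, inv_inv, mul_comm]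
  have h7 : ‖T‖ₑ ≤ schattenNorm 1 T := enorm_le_schattenNorm one_pos
  have h8 : singularNumber T 1 ≤ schattenNorm 1 T := (singularNumber_le_enorm T 1).trans h7
  simp_rw [mul_add]
  rw [ENNReal.tsum_add, h2]
  calc _ ≤ (schattenNorm 1 T + 2 * schattenNorm 1 T) + 2 * schattenNorm 1 T := by
        rw [← hN] at h1
        gcongr
        exact h1.trans (by gcongr)
    _ = 5 * schattenNorm 1 T := by ring
    _ ≤ _ := by gcongr; norm_num

/-- A Schatten class operator with `p = 1` is nuclear. -/
theorem hasNuclearBound_of_schattenNorm_lt_top {T : H →L[ℂ] H} (hT : schattenNorm 1 T < ∞) :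
    HasNuclearBound T (36 * (schattenNorm 1 T).toReal) := by
  rcases eq_or_ne T 0 with rfl | hT0
  · exact HasNuclearBound.zero.mono (by positivity)
  choose F hrank hF hF0 using exists_rank_le_enorm_sub_le T hT0
  set b : ℕ → ℝ≥0∞ := fun k => singularNumber T (2 ^ k) + ‖T‖ₑ / 4 ^ k
  have hbt : ∀ k, b k ≠ ∞ := fun k => ENNReal.add_ne_top.2 ⟨singularNumber_ne_top _ _, by
    refine ENNReal.div_ne_top enorm_ne_top (by positivity)⟩
  have hsum := tsum_two_pow_mul_le T
  have hfin : ∑' k : ℕ, 2 ^ k * b k ≠ ∞ :=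
    (hsum.trans_lt (ENNReal.mul_lt_top (by norm_num) hT)).ne
  let β : ℕ → ℝ := fun k => 2 ^ k * (b k).toReal
  have hβ : ∀ k, β k = (2 ^ k * b k).toReal := fun k => by simp [β]
  have hβ0 : ∀ k, 0 ≤ β k := fun k => by positivity
  have hβs : Summable β := by
    simp_rw [funext hβ]; exact ENNReal.summable_toReal hfin
  have hβt : ∑' k, β k ≤ 6 * (schattenNorm 1 T).toReal := by
    simp_rw [hβ]
    rw [← ENNReal.tsum_toReal_eq fun k => ENNReal.mul_ne_top (by finiteness) (hbt k)]
    have := ENNReal.toReal_mono (ENNReal.mul_lt_top (by norm_num) hT).ne hsum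
    simpa using this
  have hFb : ∀ k, ‖T - F k‖ ≤ (b k).toReal := fun k => by
    have := ENNReal.toReal_mono (hbt k) (hF k)
    simpa using this
  have hFβ : ∀ k, ‖T - F k‖ ≤ β k := fun k => (hFb k).trans
    (le_mul_of_one_le_left ENNReal.toReal_nonneg (one_le_pow₀ (by norm_num)))
  -- `T` is the telescoping sum of these differences, each of rank at most `3 * 2 ^ k` and norm at
  -- most `b k + b (k + 1)`. The total is at most `6 ∑ β k`, whence `36`.
  have hG : ∀ k, HasNuclearBound (F (k + 1) - F k) (3 * β k + 3 * β (k + 1)) := fun k => by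
    have hr : ((F (k + 1) - F k : H →L[ℂ] H) : H →ₗ[ℂ] H).rank ≤
        ((2 ^ (k + 1) + 2 ^ k : ℕ) : Cardinal) := by
      have h1 : ((F (k + 1) - F k : H →L[ℂ] H) : H →ₗ[ℂ] H)
          = (F (k + 1) : H →ₗ[ℂ] H) + (-LinearMap.id) ∘ₗ (F k : H →ₗ[ℂ] H) := by
        ext v; simp [sub_eq_add_neg]
      rw [h1, Nat.cast_add]
      exact (LinearMap.rank_add_le _ _).trans
        (add_le_add (hrank _) ((LinearMap.rank_comp_le_right _ _).trans (hrank k)))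
    refine (HasNuclearBound.of_rank_le hr).mono ?_
    have h2 : ‖F (k + 1) - F k‖ ≤ (b k).toReal + (b (k + 1)).toReal := by
      have := norm_sub_le (T - F k) (T - F (k + 1))
      rw [sub_sub_sub_cancel_left] at this
      linarith [hFb k, hFb (k + 1)]
    have h3 : (0 : ℝ) < 2 ^ k := by positivity
    have h4 := mul_le_mul_of_nonneg_left h2 (by positivity : (0 : ℝ) ≤ 3 * 2 ^ k)
    have h5 : 0 ≤ 2 ^ k * (b (k + 1)).toReal := by positivity
    simp only [β]
    push_cast
    rw [pow_succ]
    nlinarith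
  have hs1 : Summable fun k => β (k + 1) := (summable_nat_add_iff 1).2 hβs
  have hcs : Summable fun k => 3 * β k + 3 * β (k + 1) :=
    (hβs.mul_left 3).add (hs1.mul_left 3)
  refine (HasNuclearBound.of_hasSum hG hcs fun v => ?_).mono ?_
  · have hs : Summable fun k => (F (k + 1) - F k) v := by
      refine Summable.of_norm_bounded (hcs.mul_right ‖v‖) fun k => ?_
      exact ((F (k + 1) - F k).le_opNorm v).trans (by gcongr; exact (hG k).norm_le)
    rw [hs.hasSum_iff_tendsto_nat]
    have h1 : ∀ n, ∑ k ∈ Finset.range n, (F (k + 1) - F k) v = F n v := fun n => by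
      have := Finset.sum_range_sub (fun k => F k v) n
      rw [hF0 0 rfl] at this
      simpa using this
    simp only [h1]
    have h2 : Tendsto F atTop (𝓝 T) := by
      refine tendsto_iff_norm_sub_tendsto_zero.2 (squeeze_zero (fun _ => norm_nonneg _)
        (fun n => ?_) hβs.tendsto_atTop_zero)
      rw [norm_sub_rev]; exact hFβ n
    exact ((ContinuousLinearMap.apply ℂ H v).continuous.tendsto T).comp h2
  · rw [(hβs.mul_left 3).tsum_add (hs1.mul_left 3), tsum_mul_left, tsum_mul_left]
    have := hβs.tsum_eq_zero_add
    linarith [hβ0 0]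

/-- Convergence in `‖·‖_1` is convergence in nuclear bound. -/
theorem SchattenTendsto.exists_hasNuclearBound {p : ℕ} (hp : 1 ≤ p) {α : Type*} {l : Filter α}
    {f : α → H →L[ℂ] H} {S : H →L[ℂ] H} (hf : SchattenTendsto p p f l S) :
    (∃ c, HasNuclearBound S c) ∧ ∃ e : α → ℝ, Tendsto e l (𝓝 0) ∧
      ∀ᶠ a in l, HasNuclearBound (f a - S) (e a) := by
  simp only [SchattenTendsto, schattenQuotNorm_self hp] at hf
  refine ⟨⟨_, hasNuclearBound_of_schattenNorm_lt_top hf.1⟩,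
    fun a => 36 * (schattenNorm 1 (f a - S)).toReal, ?_, ?_⟩
  · simpa using ((ENNReal.tendsto_toReal ENNReal.zero_ne_top).comp hf.2).const_mul 36
  · filter_upwards [hf.2.eventually (gt_mem_nhds ENNReal.zero_lt_top)] with a ha
    exact hasNuclearBound_of_schattenNorm_lt_top ha

theorem tendsto_singularNumber {r : ℝ} (hr : 0 < r) {T : H →L[ℂ] H} (hT : schattenNorm r T < ∞) :
    Tendsto (singularNumber T) atTop (𝓝 0) := by
  have h1 : ∑' n, singularNumber T n ^ r ≠ ∞ := by
    intro h
    rw [schattenNorm, h, ENNReal.top_rpow_of_pos (by positivity)] at hT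
    exact lt_irrefl _ hT
  have h2 := ENNReal.tendsto_atTop_zero_of_tsum_ne_top h1
  have h3 := ((ENNReal.continuous_rpow_const (y := r⁻¹)).tendsto 0).comp h2
  simpa [Function.comp_def, ← ENNReal.rpow_mul, hr.ne', hr] using h3

/-- `T` is a norm limit of finite-rank operators, and for those the claim is the nuclear one. -/
theorem tendsto_mul_one_sub_basisProj {r : ℝ} (hr : 0 < r) {T : H →L[ℂ] H}
    (hT : schattenNorm r T < ∞) (h : HilbertBasis ℕ ℂ H) :
    Tendsto (fun N => T * (1 - basisProj h N)) atTop (𝓝 0) := by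
  rw [tendsto_zero_iff_norm_tendsto_zero, Metric.tendsto_atTop']
  intro ε hε
  obtain ⟨n, hn⟩ := ((tendsto_singularNumber hr hT).eventually
    (gt_mem_nhds (ENNReal.ofReal_pos.2 (by positivity : 0 < ε / 4)))).exists
  rw [singularNumber_eq_iInf, iInf_lt_iff] at hn
  obtain ⟨F, hF⟩ := hn
  rw [← ofReal_norm, ENNReal.ofReal_lt_ofReal_iff (by positivity)] at hF
  obtain ⟨e, he, hPe⟩ := (HasNuclearBound.of_rank_le F.2).exists_tendsto_basisProj h 1
  obtain ⟨N₀, hN₀⟩ := eventually_atTop.1 (he.eventually (gt_mem_nhds (by positivity : 0 < ε / 2)))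
  refine ⟨N₀, fun N hN => ?_⟩
  have h1 := (hPe N).norm_le
  rw [mul_one] at h1
  have h2 := hN₀ N hN.le
  have h3 : T * (1 - basisProj h N) = (T - F) * (1 - basisProj h N) + F * (1 - basisProj h N) := by
    noncomm_ring
  have h4 : ‖(T - F) * (1 - basisProj h N)‖ ≤ ‖T - F‖ * 2 :=
    (norm_mul_le _ _).trans (by gcongr; exact norm_one_sub_basisProj_le h N)
  rw [dist_zero_right, norm_norm, h3]
  linarith [norm_add_le ((T - F) * (1 - basisProj h N)) (F * (1 - basisProj h N))]

/-- Finite-rank truncations converge in the Schatten norm. -/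
theorem schattenTendsto_mul_basisProj {p : ℕ} (hp : 1 ≤ p) {T : H →L[ℂ] H}
    (hT : schattenNorm p T < ∞) (h : HilbertBasis ℕ ℂ H) :
    SchattenTendsto p 1 (fun N => T * basisProj h N) atTop T := by
  have hr : (0 : ℝ) < p := by positivity
  refine ⟨by rwa [schattenQuotNorm_one], ?_⟩
  have hfin : ∑' n, singularNumber T n ^ (p : ℝ) ≠ ∞ := by
    intro h
    rw [schattenNorm, h, ENNReal.top_rpow_of_pos (by positivity)] at hT
    exact lt_irrefl _ hT
  have hle : ∀ N n, singularNumber (T * basisProj h N - T) n ≤ 2 * singularNumber T n := by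
    intro N n
    have h1 : T * basisProj h N - T = T * (-(1 - basisProj h N)) := by noncomm_ring
    rw [h1, mul_comm]
    refine (singularNumber_mul_le_right _ _ n).trans ?_
    gcongr
    rw [enorm_neg, ← ofReal_norm]
    exact ENNReal.ofReal_le_of_le_toReal (by simpa using norm_one_sub_basisProj_le h N)
  have hnorm : Tendsto (fun N => ‖T * basisProj h N - T‖ₑ) atTop (𝓝 0) := by
    have h1 := (tendsto_mul_one_sub_basisProj hr hT h).enorm
    rw [enorm_zero] at h1
    refine h1.congr fun N => ?_
    rw [← enorm_neg]; congr 1; noncomm_ring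
  have h2 : Tendsto (fun N => ∑' n, singularNumber (T * basisProj h N - T) n ^ (p : ℝ)) atTop
      (𝓝 0) := by
    -- Each singular number tends to `0` with the operator norm, and `(2 * singularNumber T n) ^ p`
    -- is a summable majorant.
    have h3 := tendsto_lintegral_of_dominated_convergence (μ := (Measure.count : Measure ℕ))
      (F := fun N n => singularNumber (T * basisProj h N - T) n ^ (p : ℝ)) (f := fun _ => 0)
      (fun n => (2 * singularNumber T n) ^ (p : ℝ)) (fun N => by fun_prop)
      (fun N => Eventually.of_forall fun n => ENNReal.rpow_le_rpow (hle N n) hr.le) ?_ ?_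
    · simpa [lintegral_count] using h3
    · rw [lintegral_count]
      simp_rw [ENNReal.mul_rpow_of_nonneg _ _ hr.le]
      rw [ENNReal.tsum_mul_left]
      exact ENNReal.mul_ne_top (by finiteness) hfin
    · refine Eventually.of_forall fun n => ?_
      have h4 : Tendsto (fun N => singularNumber (T * basisProj h N - T) n) atTop (𝓝 0) :=
        tendsto_of_tendsto_of_tendsto_of_le_of_le tendsto_const_nhds hnorm (fun _ => zero_le)
          fun N => singularNumber_le_enorm _ n
      have h5 := h4.ennrpow_const (p : ℝ)
      rwa [ENNReal.zero_rpow_of_pos hr] at h5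
  have h5 := h2.ennrpow_const (1 / (p : ℝ))
  rw [ENNReal.zero_rpow_of_pos (by positivity)] at h5
  simpa only [schattenQuotNorm_one, schattenNorm] using h5

end Nuclear

end

/-! ### Polynomial identities for the truncated logarithm. -/

section

section LogPolynomial

open Polynomial

/-- The polynomial `∑_{ℓ=1}^{m} ((-1)^ℓ / ℓ) X^ℓ`, the truncated Taylor series of `-log (1 + X)`. -/
def logPoly (m : ℕ) : ℂ[X] := ∑ l ∈ Finset.range m, C ((-1 : ℂ) ^ (l + 1) / ((l + 1 : ℕ) : ℂ)) * X ^ (l + 1)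

/-- The truncated exponential series of `logPoly`. -/
def expLogPoly (m : ℕ) : ℂ[X] :=
  ∑ k ∈ Finset.range (m + 1), C ((k.factorial : ℂ)⁻¹) * logPoly m ^ k

/-- A geometric sum. It gives both the order of vanishing of the regularisation and the factor `(-1)
^ m A ^ m` in the final formula. -/
theorem one_add_X_mul_derivative_logPoly (m : ℕ) :
    (1 + X) * derivative (logPoly m) = (-X) ^ m - 1 := by
  have h1 : derivative (logPoly m) = -∑ l ∈ Finset.range m, (-X : ℂ[X]) ^ l := by
    rw [logPoly, derivative_sum, ← Finset.sum_neg_distrib]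
    refine Finset.sum_congr rfl fun l _ => ?_
    rw [derivative_C_mul_X_pow, div_mul_cancel₀ _ (by exact_mod_cast l.succ_ne_zero)]
    rw [Nat.add_sub_cancel, neg_pow (X : ℂ[X]), pow_succ]
    simp
  rw [h1, ← geom_sum_mul (-X : ℂ[X]) m]
  ring

theorem X_dvd_logPoly (m : ℕ) : X ∣ logPoly m :=
  Finset.dvd_sum fun l _ => Dvd.dvd.mul_left (dvd_pow_self X l.succ_ne_zero) _

theorem derivative_expLogPoly (m : ℕ) : derivative (expLogPoly m) =
    (expLogPoly m - C ((m.factorial : ℂ)⁻¹) * logPoly m ^ m) * derivative (logPoly m) := by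
  have h1 : expLogPoly m - C ((m.factorial : ℂ)⁻¹) * logPoly m ^ m =
      ∑ k ∈ Finset.range m, C ((k.factorial : ℂ)⁻¹) * logPoly m ^ k := by
    rw [expLogPoly, Finset.sum_range_succ, add_sub_cancel_right]
  rw [h1, expLogPoly, derivative_sum, Finset.sum_range_succ', Finset.sum_mul]
  simp only [pow_zero, mul_one, derivative_C, add_zero]
  refine Finset.sum_congr rfl fun k _ => ?_
  have h2 : ((k + 1).factorial : ℂ)⁻¹ * ((k + 1 : ℕ) : ℂ) = (k.factorial : ℂ)⁻¹ := by
    have := Nat.cast_ne_zero (R := ℂ).2 k.factorial_ne_zero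
    have h3 : (k : ℂ) + 1 ≠ 0 := by exact_mod_cast k.succ_ne_zero
    rw [Nat.factorial_succ]; push_cast; field_simp
  rw [derivative_C_mul, derivative_pow, ← h2, C_mul, Nat.add_sub_cancel, C_eq_natCast]
  ring

theorem X_pow_dvd_of_derivative {P : ℂ[X]} {m : ℕ} (h0 : P.coeff 0 = 0)
    (h : X ^ m ∣ derivative P) : X ^ (m + 1) ∣ P := by
  rw [X_pow_dvd_iff] at h ⊢
  rintro (_ | d) hd
  · exact h0
  · have h1 := h d (by omega)
    rw [coeff_derivative] at h1
    exact (mul_eq_zero.1 h1).resolve_right (by exact_mod_cast d.succ_ne_zero)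

/-- The constant term vanishes. In the derivative everything cancels except multiples of `X ^ m` and
`logPoly m ^ m`, and `X` divides `logPoly m`. -/
theorem X_pow_dvd_expLogPoly (m : ℕ) : X ^ (m + 1) ∣ (1 + X) * expLogPoly m - 1 := by
  refine X_pow_dvd_of_derivative ?_ ?_
  · obtain ⟨r, hr⟩ := X_dvd_logPoly m
    have h1 : (logPoly m).coeff 0 = 0 := by rw [hr, coeff_X_mul_zero]
    have h2 : (expLogPoly m).coeff 0 = 1 := by
      rw [coeff_zero_eq_eval_zero] at h1 ⊢
      rw [expLogPoly, eval_finsetSum, Finset.sum_range_succ']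
      simp [h1]
    rw [coeff_sub, mul_coeff_zero, h2]
    simp
  · have h1 : derivative ((1 + X) * expLogPoly m - 1) =
        (-X) ^ m * (expLogPoly m - C ((m.factorial : ℂ)⁻¹) * logPoly m ^ m)
          + C ((m.factorial : ℂ)⁻¹) * logPoly m ^ m := by
      rw [derivative_sub, derivative_mul, derivative_expLogPoly]
      have := one_add_X_mul_derivative_logPoly m
      simp only [derivative_add, derivative_one, derivative_X, zero_add, one_mul, sub_zero]
      linear_combination (expLogPoly m - C ((m.factorial : ℂ)⁻¹) * logPoly m ^ m) * this
    rw [h1]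
    refine dvd_add (Dvd.dvd.mul_right ?_ _) (Dvd.dvd.mul_left (pow_dvd_pow_of_dvd (X_dvd_logPoly m) m) _)
    rw [neg_pow]
    exact Dvd.dvd.mul_left dvd_rfl _

end LogPolynomial

/-! ### Entire functions on a Banach algebra. -/

section PowerSeries

variable {𝔸 : Type*} [NormedRing 𝔸] [NormedAlgebra ℂ 𝔸]

theorem pow_sub_pow_eq_sum (x y : 𝔸) (n : ℕ) :
    x ^ n - y ^ n = ∑ i ∈ Finset.range n, x ^ (n - 1 - i) * (x - y) * y ^ i := by
  induction n with
  | zero => simp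
  | succ n ih =>
    rw [Finset.sum_range_succ]
    have h1 : ∀ i ∈ Finset.range n, x ^ (n + 1 - 1 - i) * (x - y) * y ^ i
        = x * (x ^ (n - 1 - i) * (x - y) * y ^ i) := fun i hi => by
      have : n + 1 - 1 - i = n - 1 - i + 1 := by have := Finset.mem_range.1 hi; omega
      rw [this, pow_succ']; simp only [mul_assoc]
    rw [Finset.sum_congr rfl h1, ← Finset.mul_sum, ← ih, Nat.add_sub_cancel, Nat.sub_self, pow_zero,
      one_mul, pow_succ', pow_succ']
    noncomm_ring

/-- The derivative of `X ↦ X ^ n` at `X` in the direction `Y`. -/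
def powDeriv (X Y : 𝔸) (n : ℕ) : 𝔸 := ∑ i ∈ Finset.range n, X ^ (n - 1 - i) * Y * X ^ i

theorem exists_hasFDerivAt_pow (X : 𝔸) (n : ℕ) :
    ∃ D : 𝔸 →L[ℂ] 𝔸, HasFDerivAt (fun X : 𝔸 => X ^ n) D X ∧ ∀ Y, D Y = powDeriv X Y n :=
  ⟨_, hasFDerivAt_pow' n, fun Y => by simp [powDeriv, sum_apply]⟩

variable [NormOneClass 𝔸]

theorem norm_powDeriv_le (X Y : 𝔸) (n : ℕ) : ‖powDeriv X Y n‖ ≤ n * ‖X‖ ^ (n - 1) * ‖Y‖ := by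
  refine (norm_sum_le _ _).trans ?_
  have h1 : ∀ i ∈ Finset.range n, ‖X ^ (n - 1 - i) * Y * X ^ i‖ ≤ ‖X‖ ^ (n - 1) * ‖Y‖ :=
    fun i hi => by
      have h2 : n - 1 = (n - 1 - i) + i := by have := Finset.mem_range.1 hi; omega
      calc _ ≤ ‖X‖ ^ (n - 1 - i) * ‖Y‖ * ‖X‖ ^ i := by
            refine (norm_mul_le _ _).trans ?_
            gcongr
            · exact (norm_mul_le _ _).trans (by gcongr; exact norm_pow_le X _)
            · exact norm_pow_le X _
        _ = ‖X‖ ^ (n - 1) * ‖Y‖ := by conv_rhs => rw [h2, pow_add]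
                                      ring
  refine (Finset.sum_le_sum h1).trans ?_
  simp [mul_assoc]

/-- The coefficients of an entire function. -/
def EntireCoeff (c : ℕ → ℂ) : Prop := ∀ r : ℝ, 0 ≤ r → Summable fun n => ‖c n‖ * r ^ n

theorem EntireCoeff.summable_deriv {c : ℕ → ℂ} (hc : EntireCoeff c) {r : ℝ} (hr : 0 ≤ r) :
    Summable fun n => ‖c n‖ * (n * r ^ (n - 1)) := by
  refine (hc (2 * (r + 1)) (by positivity)).of_nonneg_of_le (fun n => by positivity) fun n => ?_
  gcongr
  rw [mul_pow]
  gcongr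
  · exact_mod_cast Nat.lt_two_pow_self.le
  · calc r ^ (n - 1) ≤ (r + 1) ^ (n - 1) := by gcongr; linarith
      _ ≤ (r + 1) ^ n := pow_le_pow_right₀ (by linarith) (Nat.sub_le n 1)

variable [CompleteSpace 𝔸]

/-- Termwise differentiation on a ball slightly larger than `‖X‖`. The derivative is kept as an
explicit series so that its trace can be taken term by term. -/
theorem EntireCoeff.exists_hasFDerivAt {c : ℕ → ℂ} (hc : EntireCoeff c) (X : 𝔸) :
    ∃ D : 𝔸 →L[ℂ] 𝔸, HasFDerivAt (fun X : 𝔸 => ∑' n, c n • X ^ n) D X ∧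
      ∀ Y, HasSum (fun n => c n • powDeriv X Y n) (D Y) := by
  choose P hP hPY using fun (n : ℕ) (X : 𝔸) => exists_hasFDerivAt_pow X n
  have hR : ‖X‖ < ‖X‖ + 1 := lt_add_one _
  set R := ‖X‖ + 1
  have hR0 : 0 ≤ R := by positivity
  have hu := hc.summable_deriv hR0
  have hle : ∀ n, ∀ x ∈ Metric.ball (0 : 𝔸) R, ‖c n • P n x‖ ≤ ‖c n‖ * (n * R ^ (n - 1)) :=
    fun n x hx => by
      rw [norm_smul]
      gcongr
      refine ContinuousLinearMap.opNorm_le_bound _ (by positivity) fun Y => ?_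
      rw [hPY]
      refine (norm_powDeriv_le x Y n).trans ?_
      have := (mem_ball_zero_iff.1 hx).le
      gcongr
  have hX : X ∈ Metric.ball (0 : 𝔸) R := by rwa [mem_ball_zero_iff]
  have h0 : Summable fun n => c n • (0 : 𝔸) ^ n :=
    summable_of_ne_finset_zero (s := {0}) fun n hn => by
      rw [zero_pow (by simpa using hn), smul_zero]
  refine ⟨∑' n, c n • P n X, ?_, fun Y => ?_⟩
  · exact hasFDerivAt_tsum_of_isPreconnected (f := fun n (X : 𝔸) => c n • X ^ n)
      (f' := fun n X => c n • P n X) hu Metric.isOpen_ball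
      (convex_ball (0 : 𝔸) R).isPreconnected (fun n x _ => (hP n x).const_smul (c n)) hle
      (Metric.mem_ball_self (by positivity)) h0 hX
  · have h1 : Summable fun n => c n • P n X := Summable.of_norm_bounded hu fun n => hle n X hX
    have h2 := h1.hasSum.mapL (ContinuousLinearMap.apply ℂ 𝔸 Y)
    simpa [hPY] using h2

theorem entireCoeff_inv_factorial (m : ℕ) :
    EntireCoeff fun n => (((n + m).factorial : ℂ))⁻¹ := fun r hr => by
  refine (Real.summable_pow_div_factorial r).of_nonneg_of_le (fun n => by positivity) fun n => ?_
  rw [norm_inv, Complex.norm_natCast, div_eq_inv_mul]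
  gcongr
  omega

theorem entireCoeff_polynomial (q : Polynomial ℂ) : EntireCoeff q.coeff := fun r _ =>
  summable_of_ne_finset_zero (s := q.support) fun n hn => by
    rw [Polynomial.notMem_support_iff.1 hn, norm_zero, zero_mul]

theorem hasSum_aeval (q : Polynomial ℂ) (X : 𝔸) :
    HasSum (fun n => q.coeff n • X ^ n) (Polynomial.aeval X q) := by
  rw [Polynomial.aeval_eq_sum_range]
  exact hasSum_sum_of_ne_finset_zero fun n hn => by
    rw [Polynomial.coeff_eq_zero_of_natDegree_lt (by simpa [Nat.lt_succ_iff] using hn), zero_smul]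

theorem hasSum_exp (X : 𝔸) :
    HasSum (fun n : ℕ => ((n.factorial : ℂ))⁻¹ • X ^ n) (NormedSpace.exp X) :=
  NormedSpace.exp_series_hasSum_exp' (𝕂 := ℂ) X

theorem differentiable_aeval (q : Polynomial ℂ) :
    Differentiable ℂ fun X : 𝔸 => Polynomial.aeval X q := fun X => by
  obtain ⟨D, hD, -⟩ := (entireCoeff_polynomial q).exists_hasFDerivAt X
  simp only [(hasSum_aeval q _).tsum_eq] at hD
  exact hD.differentiableAt

/-- The regularised exponential is divisible by `A ^ (m + 1)`, with an entire quotient. -/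
theorem exists_eq_pow_mul (m : ℕ) : ∃ g : 𝔸 → 𝔸, Differentiable ℂ g ∧ ∀ A : 𝔸,
    (1 + A) * NormedSpace.exp (Polynomial.aeval A (logPoly m)) - 1 = A ^ (m + 1) * g A := by
  obtain ⟨π, hπ⟩ := X_pow_dvd_expLogPoly m
  obtain ⟨r, hr⟩ := X_dvd_logPoly m
  let R : 𝔸 → 𝔸 := fun X => ∑' n : ℕ, (((n + (m + 1)).factorial : ℂ))⁻¹ • X ^ n
  have hR : Differentiable ℂ R := fun X => by
    obtain ⟨D, hD, -⟩ := (entireCoeff_inv_factorial (m + 1)).exists_hasFDerivAt X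
    exact hD.differentiableAt
  have hexp : ∀ Q : 𝔸, NormedSpace.exp Q =
      ∑ k ∈ Finset.range (m + 1), ((k.factorial : ℂ))⁻¹ • Q ^ k + Q ^ (m + 1) * R Q := fun Q => by
    have h1 := hasSum_exp Q
    have hs : Summable fun n : ℕ => (((n + (m + 1)).factorial : ℂ))⁻¹ • Q ^ n := by
      refine Summable.of_norm_bounded (entireCoeff_inv_factorial (m + 1) ‖Q‖ (norm_nonneg _))
        fun n => ?_
      rw [norm_smul]
      gcongr
      exact norm_pow_le Q n
    have h2 := hs.hasSum.mul_left (Q ^ (m + 1))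
    have h3 : HasSum (fun n : ℕ => (((n + (m + 1)).factorial : ℂ))⁻¹ • Q ^ (n + (m + 1)))
        (Q ^ (m + 1) * R Q) := by
      refine h2.congr_fun fun n => ?_
      rw [mul_smul_comm, ← pow_add, add_comm n]
    exact h1.unique ((hasSum_nat_add_iff' (m + 1)).1 (by simpa using h3))
  -- The first summand comes from the truncated exponential. The second comes from its tail, which
  -- carries `q(A) ^ (m + 1) = A ^ (m + 1) r(A) ^ (m + 1)`.
  refine ⟨fun A => Polynomial.aeval A π + (1 + A) * (Polynomial.aeval A r ^ (m + 1) *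
    R (Polynomial.aeval A (logPoly m))), ?_, fun A => ?_⟩
  · have h1 := differentiable_aeval (𝔸 := 𝔸) π
    have h2 := differentiable_aeval (𝔸 := 𝔸) r
    have h3 := hR.comp (differentiable_aeval (𝔸 := 𝔸) (logPoly m))
    have h4 : Differentiable ℂ fun A : 𝔸 => Polynomial.aeval A r ^ (m + 1) := h2.pow _
    exact h1.add (((differentiable_const _).add differentiable_id).mul (h4.mul h3))
  · have h1 : ∑ k ∈ Finset.range (m + 1), ((k.factorial : ℂ))⁻¹ •
        Polynomial.aeval A (logPoly m) ^ k = Polynomial.aeval A (expLogPoly m) := by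
      simp [expLogPoly, Algebra.smul_def]
    have h2 : (1 + A) * Polynomial.aeval A (expLogPoly m) - 1 = A ^ (m + 1) * Polynomial.aeval A π := by
      have := congrArg (Polynomial.aeval A) hπ
      simpa using this
    have h3 : Polynomial.aeval A (logPoly m) ^ (m + 1)
        = A ^ (m + 1) * Polynomial.aeval A r ^ (m + 1) := by
      have := congrArg (fun s => Polynomial.aeval A (s ^ (m + 1))) hr
      simpa [_root_.mul_pow] using this
    have h4 : (1 + A) * A ^ (m + 1) = A ^ (m + 1) * (1 + A) := by
      rw [add_mul, mul_add, one_mul, mul_one, ← pow_succ, ← pow_succ']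
    rw [hexp, h1, mul_add, add_sub_right_comm, h2, h3, mul_add, ← mul_assoc, ← mul_assoc, h4]
    simp only [mul_assoc]

end PowerSeries

end

/-! ### Traces of derivatives and continuity of the trace. -/

section

variable {H : Type*} [NormedAddCommGroup H] [InnerProductSpace ℂ H] [CompleteSpace H]

section TraceDerivative

variable [Nonempty (HilbertBasis ℕ ℂ H)] [Nontrivial H]

theorem HasNuclearBound.powDeriv {X Y : H →L[ℂ] H} {b : ℝ} (hY : HasNuclearBound Y b) (n : ℕ) :
    HasNuclearBound (powDeriv X Y n) (n * ‖X‖ ^ (n - 1) * b) := by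
  have hb := hY.nonneg
  have h1 : ∀ i ∈ Finset.range n,
      HasNuclearBound (X ^ (n - 1 - i) * Y * X ^ i) (‖X‖ ^ (n - 1) * b) := fun i hi => by
    refine ((hY.mul_left (X ^ (n - 1 - i))).mul_right (X ^ i)).mono ?_
    have h2 : n - 1 = (n - 1 - i) + i := by have := Finset.mem_range.1 hi; omega
    calc _ ≤ ‖X‖ ^ (n - 1 - i) * b * ‖X‖ ^ i := by
          gcongr
          · exact norm_pow_le X _
          · exact norm_pow_le X _
      _ = ‖X‖ ^ (n - 1) * b := by
          conv_rhs => rw [h2, pow_add]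
          ring
  refine (HasNuclearBound.sum _ h1).mono (le_of_eq ?_)
  simp [mul_assoc]

/-- Cyclicity brings the right factor `X ^ i` to the front and `T` commutes with it, so all `n`
terms have the same trace. -/
theorem trace_mul_powDeriv {T X Y : H →L[ℂ] H} {b : ℝ} (hTX : Commute T X)
    (hY : HasNuclearBound Y b) (n : ℕ) :
    trace (T * powDeriv X Y n) = n * trace (T * X ^ (n - 1) * Y) := by
  rw [powDeriv, Finset.mul_sum, HasNuclearBound.trace_sum (b := fun i =>
    ‖T‖ * (‖X ^ (n - 1 - i)‖ * b * ‖X ^ i‖)) _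
    fun i _ => ((hY.mul_left (X ^ (n - 1 - i))).mul_right (X ^ i)).mul_left T]
  have h1 : ∀ i ∈ Finset.range n, trace (T * (X ^ (n - 1 - i) * Y * X ^ i)) =
      trace (T * X ^ (n - 1) * Y) := fun i hi => by
    have h2 : n - 1 = i + (n - 1 - i) := by have := Finset.mem_range.1 hi; omega
    have h3 := ((hY.mul_left (X ^ (n - 1 - i))).mul_left T).trace_mul_comm (X ^ i)
    rw [← mul_assoc T, ← h3, ← mul_assoc, ← (hTX.pow_right i).eq, mul_assoc, ← mul_assoc (X ^ i),
      ← pow_add, ← h2, mul_assoc]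
  rw [Finset.sum_congr rfl h1]
  simp

/-- The trace of the derivative of an entire function against an operator in the commutant. -/
theorem EntireCoeff.trace_mul_deriv {c : ℕ → ℂ} (hc : EntireCoeff c) {T X Y D Z : H →L[ℂ] H} {b : ℝ}
    (hTX : Commute T X) (hY : HasNuclearBound Y b)
    (hD : HasSum (fun n => c n • SchattenUnitaries.powDeriv X Y n) D)
    (hZ : HasSum (fun n => (c (n + 1) * ((n + 1 : ℕ) : ℂ)) • X ^ n) Z) :
    (∃ b', HasNuclearBound D b') ∧ trace (T * D) = trace (T * Z * Y) := by
  have hs := (hc.summable_deriv (norm_nonneg X)).mul_right b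
  have hR : ∀ n, HasNuclearBound (c n • SchattenUnitaries.powDeriv X Y n)
      (‖c n‖ * (n * ‖X‖ ^ (n - 1)) * b) := fun n => by
    have := (hY.powDeriv (X := X) n).smul (c n)
    simpa only [mul_assoc] using this
  have hDv : ∀ v, HasSum (fun n => (c n • SchattenUnitaries.powDeriv X Y n) v) (D v) := fun v =>
    hD.mapL (ContinuousLinearMap.apply ℂ H v)
  -- The index shift is harmless: the term `n = 0` carries the factor `n`.
  have hZ' : HasSum (fun n => (c n * (n : ℂ)) • X ^ (n - 1)) Z := by
    refine (hasSum_nat_add_iff' 1).1 ?_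
    simpa using hZ
  have hZv : ∀ v, HasSum (fun n => (T * ((c n * (n : ℂ)) • X ^ (n - 1)) * Y) v) ((T * Z * Y) v) :=
    fun v => ((hZ'.mul_left T).mul_right Y).mapL (ContinuousLinearMap.apply ℂ H v)
  have hRZ : ∀ n, HasNuclearBound (T * ((c n * (n : ℂ)) • X ^ (n - 1)) * Y)
      (‖T‖ * (‖c n‖ * (n * ‖X‖ ^ (n - 1)) * b)) := fun n => by
    refine (hY.mul_left _).mono ?_
    have hb := hY.nonneg
    rw [← mul_assoc]
    gcongr
    refine (norm_mul_le _ _).trans ?_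
    gcongr
    rw [norm_smul, norm_mul, Complex.norm_natCast, mul_assoc]
    gcongr
    exact norm_pow_le X _
  refine ⟨⟨_, HasNuclearBound.of_hasSum hR hs hDv⟩, ?_⟩
  have h1 := HasNuclearBound.hasSum_trace (T := T * D) (fun n => (hR n).mul_left T)
    (hs.mul_left ‖T‖) fun v => (hDv v).mapL T
  have h2 := HasNuclearBound.hasSum_trace hRZ (hs.mul_left ‖T‖) hZv
  refine h1.unique (h2.congr_fun fun n => ?_)
  rw [mul_smul_comm, mul_smul_comm, smul_mul_assoc, ((hY.powDeriv n).mul_left T).trace_smul,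
    trace_mul_powDeriv hTX hY, (hY.mul_left (T * X ^ (n - 1))).trace_smul, mul_assoc (c n)]

theorem exp_neg_mul_exp (Q : H →L[ℂ] H) : NormedSpace.exp (-Q) * NormedSpace.exp Q = 1 := by
  let _ : NormedAlgebra ℚ (H →L[ℂ] H) := NormedAlgebra.restrictScalars ℚ ℂ _
  rw [← NormedSpace.exp_add_of_commute (Commute.neg_left (Commute.refl Q)),
    neg_add_cancel, NormedSpace.exp_zero]

theorem exp_mul_exp_neg (Q : H →L[ℂ] H) : NormedSpace.exp Q * NormedSpace.exp (-Q) = 1 := by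
  simpa using exp_neg_mul_exp (-Q)

open Polynomial in
/-- The logarithmic derivative of the regularised determinant in a nuclear direction. -/
theorem trace_deriv_of_nuclear {m : ℕ} {A V B : H →L[ℂ] H} {b : ℝ} (hB : HasNuclearBound B b)
    (hV : V * (1 + A) = 1) (hVA : Commute V A) {D : (H →L[ℂ] H) →L[ℂ] (H →L[ℂ] H)}
    (hD : HasFDerivAt
      (fun A : H →L[ℂ] H => (1 + A) * NormedSpace.exp (aeval A (logPoly m)) - 1) D A) :
    (∃ b', HasNuclearBound (D B) b') ∧
      trace (NormedSpace.exp (-aeval A (logPoly m)) * V * D B) =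
        (-1) ^ m * trace (V * B * A ^ m) := by
  set Q := aeval A (logPoly m)
  set W := NormedSpace.exp (-Q)
  obtain ⟨Dq, hDq, hDqY⟩ := (entireCoeff_polynomial (logPoly m)).exists_hasFDerivAt A
  obtain ⟨De, hDe, hDeY⟩ := (entireCoeff_inv_factorial 0).exists_hasFDerivAt Q
  simp only [(hasSum_aeval (logPoly m) _).tsum_eq] at hDq
  simp only [add_zero, (hasSum_exp _).tsum_eq] at hDe
  have hDB : D B = B * NormedSpace.exp Q + (1 + A) * De (Dq B) := by
    have h1 := (((hasFDerivAt_id (𝕜 := ℂ) A).const_add 1).mul' (hDe.comp A hDq)).sub_const 1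
    have h2 := hD.unique h1
    rw [h2]
    simp [add_comm, Q]
  obtain ⟨⟨b₁, hb₁⟩, htr₁⟩ := (entireCoeff_polynomial (logPoly m)).trace_mul_deriv (T := 1)
    (Z := aeval A (derivative (logPoly m))) (Commute.one_left A) hB (hDqY B) (by
      refine (hasSum_aeval (derivative (logPoly m)) A).congr_fun fun n => ?_
      rw [coeff_derivative]; push_cast; rfl)
  have hWQ : Commute W Q := (((Commute.refl Q).neg_right).exp_right).symm
  obtain ⟨⟨b₂, hb₂⟩, htr₂⟩ := (entireCoeff_inv_factorial 0).trace_mul_deriv (T := W)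
    (Z := NormedSpace.exp Q) hWQ hb₁ (hDeY (Dq B)) (by
      refine (hasSum_exp Q).congr_fun fun n => ?_
      congr 1
      have := Nat.cast_ne_zero (R := ℂ).2 n.factorial_ne_zero
      have h3 : (n : ℂ) + 1 ≠ 0 := by exact_mod_cast n.succ_ne_zero
      rw [add_zero, Nat.factorial_succ]; push_cast; field_simp)
  have hnuc := (hB.mul_right (NormedSpace.exp Q)).add (hb₂.mul_left (1 + A))
  rw [hDB]
  refine ⟨⟨_, hnuc⟩, ?_⟩
  have hWV : W * V * (1 + A) = W := by rw [mul_assoc, hV, mul_one]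
  have h1 : trace (W * V * (B * NormedSpace.exp Q)) = trace (V * B) := by
    rw [← mul_assoc, ← (hB.mul_left (W * V)).trace_mul_comm, mul_assoc, ← mul_assoc, exp_mul_exp_neg,
      one_mul]
  have h2 : trace (W * V * ((1 + A) * De (Dq B))) = trace (aeval A (derivative (logPoly m)) * B) := by
    rw [← mul_assoc, hWV, htr₂, exp_neg_mul_exp, htr₁, one_mul]
  have h3 : (1 + A) * aeval A (derivative (logPoly m)) = (-A) ^ m - 1 := by
    have := congrArg (aeval A) (one_add_X_mul_derivative_logPoly m)
    simpa using this
  -- The two halves of the product rule have traces `Tr(V B)` and `Tr(q'(A) B)`; their coefficients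
  -- combine to `V (1 + (1 + A) q'(A)) = V (-A) ^ m`.
  have h4 : V + aeval A (derivative (logPoly m)) = (-1 : ℂ) ^ m • (A ^ m * V) := by
    calc _ = V * 1 + V * (1 + A) * aeval A (derivative (logPoly m)) := by rw [hV, one_mul, mul_one]
      _ = V * (-A) ^ m := by rw [mul_assoc, h3, ← mul_add, add_sub_cancel]
      _ = _ := by
        rw [← (hVA.pow_right m).eq, ← mul_smul_comm]
        congr 1
        rw [neg_eq_neg_one_mul, ← neg_one_smul ℂ (1 : H →L[ℂ] H), smul_mul_assoc, one_mul, _root_.smul_pow]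
  have h5 := (hB.mul_left V)
  rw [mul_add, ((hB.mul_right _).mul_left _).trace_add ((hb₂.mul_left _).mul_left _), h1, h2,
    ← (hB.mul_left V).trace_add (hB.mul_left _), ← add_mul, h4, smul_mul_assoc, mul_assoc,
    (h5.mul_left _).trace_smul, h5.trace_mul_comm]

end TraceDerivative

section Schatten

variable {p : ℕ} {α : Type*} {l : Filter α}

theorem SchattenTendsto.congr' {k : ℕ} {f g : α → H →L[ℂ] H} {S : H →L[ℂ] H}
    (hf : SchattenTendsto p k f l S) (h : f =ᶠ[l] g) : SchattenTendsto p k g l S :=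
  ⟨hf.1, hf.2.congr' (h.fun_comp fun T => schattenQuotNorm p k (T - S))⟩

/-- Convergence of the difference quotients of `A ↦ A ^ p g(A)` in the trace norm. -/
theorem SchattenTendsto.powDeriv (hp : 1 ≤ p) {X C G : α → H →L[ℂ] H} {A B G₀ : H →L[ℂ] H}
    (hX : SchattenTendsto p 1 X l A) (hC : SchattenTendsto p 1 C l B) (hG : Tendsto G l (𝓝 G₀))
    (K : H →L[ℂ] H) :
    SchattenTendsto p p
      (fun a => (∑ i ∈ Finset.range p, X a ^ (p - 1 - i) * C a * A ^ i) * K + X a ^ p * G a) l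
      (SchattenUnitaries.powDeriv A B p * K + A ^ p * G₀) := by
  refine SchattenTendsto.add le_rfl (SchattenTendsto.mul_tendsto le_rfl
    (SchattenTendsto.sum le_rfl _ fun i hi => ?_) tendsto_const_nhds)
    ((hX.pow le_rfl).mul_tendsto le_rfl hG)
  have hi' := Finset.mem_range.1 hi
  have h1 := ((hX.pow (k := p - 1 - i) (by omega)).mul (by omega) hC).mul_pow
    (SchattenTendsto.const hp hX.1) (j := i) (by omega)
  have h2 : p - 1 - i + 1 + i = p := by omega
  rwa [h2] at h1

variable [Nonempty (HilbertBasis ℕ ℂ H)]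

theorem tendsto_trace {p : ℕ} (hp : 1 ≤ p) {f : α → H →L[ℂ] H} {S : H →L[ℂ] H}
    (hf : SchattenTendsto p p f l S) : Tendsto (fun a => trace (f a)) l (𝓝 (trace S)) := by
  obtain ⟨⟨c, hc⟩, e, he, hfe⟩ := hf.exists_hasNuclearBound hp
  rw [tendsto_iff_norm_sub_tendsto_zero]
  refine squeeze_zero' (Eventually.of_forall fun _ => norm_nonneg _) ?_ he
  filter_upwards [hfe] with a ha
  have h1 := ha.trace_add hc
  rw [sub_add_cancel] at h1
  rw [h1, add_sub_cancel_right]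
  exact ha.norm_trace_le

end Schatten

/-! ### Jacobi's formula and the regularised determinant. -/

section Derivative

variable [Nonempty (HilbertBasis ℕ ℂ H)]

/-- Jacobi's formula for the Fredholm determinant. -/
theorem hasDerivAt_fredholmDet {f : ℝ → H →L[ℂ] H} {t c d : ℝ} {D V : H →L[ℂ] H} {e : ℝ → ℝ}
    (hf : HasNuclearBound (f t) c) (hD : HasNuclearBound D d) (he : Tendsto e (𝓝[≠] t) (𝓝 0))
    (hfe : ∀ᶠ s in 𝓝[≠] t, HasNuclearBound (((s - t : ℝ) : ℂ)⁻¹ • (f s - f t) - D) (e s))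
    (hV : (1 + f t) * V = 1) :
    HasDerivAt (fun s => fredholmDet (f s)) (fredholmDet (f t) * trace (V * D)) t := by
  -- Chosen so that `1 + f s = (1 + f t) (1 + L s)`: multiplicativity reduces the claim to the
  -- expansion of the determinant at the identity.
  let L : ℝ → H →L[ℂ] H := fun s => V * (f s - f t)
  have hVD := hD.mul_left V
  have hL : ∀ᶠ s in 𝓝[≠] t, HasNuclearBound (((s - t : ℝ) : ℂ)⁻¹ • L s - V * D) (‖V‖ * e s) ∧
      HasNuclearBound (L s) (|s - t| * (‖V‖ * e s + ‖V‖ * d)) := by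
    filter_upwards [hfe, self_mem_nhdsWithin] with s hs hst
    have hst' : ((s - t : ℝ) : ℂ) ≠ 0 := by exact_mod_cast sub_ne_zero.2 hst
    have h1 := hs.mul_left V
    rw [mul_sub, mul_smul_comm] at h1
    refine ⟨h1, ?_⟩
    have h2 := (h1.add hVD).smul ((s - t : ℝ) : ℂ)
    rwa [sub_add_cancel, smul_smul, mul_inv_cancel₀ hst', one_smul, Complex.norm_real,
      Real.norm_eq_abs] at h2
  have hmul : ∀ᶠ s in 𝓝[≠] t, fredholmDet (f s) = fredholmDet (f t) * fredholmDet (L s) := by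
    filter_upwards [hL] with s hs
    rw [← hf.fredholmDet_mul hs.2]
    congr 1
    have : f t + L s + f t * L s = f t + (1 + f t) * V * (f s - f t) := by
      simp only [L]; noncomm_ring
    rw [this, hV, one_mul, add_sub_cancel]
  rw [hasDerivAt_iff_tendsto_slope]
  have hlim : Tendsto (fun s => ((s - t : ℝ) : ℂ)⁻¹ * (fredholmDet (L s) - 1)) (𝓝[≠] t)
      (𝓝 (trace (V * D))) := by
    rw [tendsto_iff_norm_sub_tendsto_zero]
    have habs : Tendsto (fun s : ℝ => |s - t|) (𝓝[≠] t) (𝓝 0) := by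
      have : Tendsto (fun s : ℝ => |s - t|) (𝓝 t) (𝓝 |t - t|) :=
        (continuous_abs.comp (continuous_id.sub continuous_const)).tendsto t
      rw [sub_self, abs_zero] at this
      exact this.mono_left nhdsWithin_le_nhds
    have hK : Tendsto (fun s => ‖V‖ * e s + ‖V‖ * d + 1) (𝓝[≠] t) (𝓝 (‖V‖ * 0 + ‖V‖ * d + 1)) :=
      ((he.const_mul _).add_const _).add_const _
    have hbound := ((habs.mul (hK.pow 2)).const_mul (Real.exp 2 + 2)).add (he.const_mul ‖V‖)
    rw [zero_mul, mul_zero, mul_zero, add_zero] at hbound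
    refine squeeze_zero' (Eventually.of_forall fun _ => norm_nonneg _) ?_ hbound
    have hsmall := habs.mul hK
    rw [zero_mul] at hsmall
    filter_upwards [hL, self_mem_nhdsWithin, hsmall.eventually (gt_mem_nhds one_pos)]
      with s hs hst hs1
    have hst0 : 0 < |s - t| := abs_pos.2 (sub_ne_zero.2 hst)
    have hst' : ((s - t : ℝ) : ℂ) ≠ 0 := by exact_mod_cast sub_ne_zero.2 hst
    have hnorm : ‖((s - t : ℝ) : ℂ)⁻¹‖ = |s - t|⁻¹ := by
      rw [norm_inv, Complex.norm_real, Real.norm_eq_abs]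
    set κ := ‖V‖ * e s + ‖V‖ * d
    have hκ : 0 ≤ κ := by
      have := hs.2.nonneg
      exact nonneg_of_mul_nonneg_right this hst0
    -- `κ` may vanish; `κ + 1` provides the strictly positive bound required.
    have h1 := (hs.2.mono (d := |s - t| * (κ + 1)) (by gcongr; linarith)).norm_fredholmDet_sub_le
      (by positivity) hs1.le
    have h2 : trace (((s - t : ℝ) : ℂ)⁻¹ • L s) = ((s - t : ℝ) : ℂ)⁻¹ * trace (L s) :=
      hs.2.trace_smul _
    have h3 := (hs.2.smul ((s - t : ℝ) : ℂ)⁻¹).trace_sub hVD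
    have h4 := hs.1.norm_trace_le
    rw [h3, h2] at h4
    have h5 : ((s - t : ℝ) : ℂ)⁻¹ * (fredholmDet (L s) - 1) - trace (V * D) =
        ((s - t : ℝ) : ℂ)⁻¹ * (fredholmDet (L s) - 1 - trace (L s)) +
          (((s - t : ℝ) : ℂ)⁻¹ * trace (L s) - trace (V * D)) := by ring
    rw [h5]
    refine (norm_add_le _ _).trans (add_le_add ?_ h4)
    rw [norm_mul, hnorm]
    calc _ ≤ |s - t|⁻¹ * ((Real.exp 2 + 2) * (|s - t| * (κ + 1)) ^ 2) := by gcongr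
      _ = _ := by field_simp
  refine (hlim.const_mul (fredholmDet (f t))).congr' ?_
  filter_upwards [hmul] with s hs
  rw [slope_def_module, hs, Complex.real_smul]
  push_cast
  ring

end Derivative

section RegDet

open Polynomial in
theorem regularisation_eq (m : ℕ) (U : H →L[ℂ] H) : regularisation (m + 1) U =
    (1 + (U - 1)) * NormedSpace.exp (aeval (U - 1) (logPoly m)) - 1 := by
  rw [regularisation, add_sub_cancel, Finset.sum_Ico_eq_sum_range, Nat.add_sub_cancel]
  congr 3
  simp [logPoly, Algebra.smul_def, add_comm 1]

variable [Nonempty (HilbertBasis ℕ ℂ H)]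

-- The formula holds at every point of differentiability of the path.
open Polynomial in
theorem hasDerivAt_regDet {m : ℕ} {U : ℝ → H →L[ℂ] H} {t : ℝ} {B : H →L[ℂ] H}
    (hUt : U t ∈ schattenUnitaries H ((m + 1 : ℕ) : ℝ))
    (hB : HasSchattenDerivAt ((m + 1 : ℕ) : ℝ) U B t) :
    regularisation (m + 1) (U t) ∈ schattenClass H 1 ∧ regDet (m + 1) (U t) ≠ 0 ∧
      star (U t) * B * (U t - 1) ^ m ∈ schattenClass H 1 ∧
      HasDerivAt (fun s => regDet (m + 1) (U s))
        (regDet (m + 1) (U t) * ((-1) ^ m * trace (star (U t) * B * (U t - 1) ^ m))) t := by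
  obtain ⟨h₀⟩ := id ‹Nonempty (HilbertBasis ℕ ℂ H)›
  have : Nontrivial H := ⟨h₀ 0, 0, h₀.orthonormal.ne_zero 0⟩
  have hp : 1 ≤ m + 1 := by omega
  obtain ⟨g, hg, hfg⟩ := exists_eq_pow_mul (𝔸 := H →L[ℂ] H) m
  let F : (H →L[ℂ] H) → (H →L[ℂ] H) := fun A => A ^ (m + 1) * g A
  have hreg : ∀ s, regularisation (m + 1) (U s) = F (U s - 1) := fun s => by
    rw [regularisation_eq, hfg]
  set A := U t - 1 with hA
  set V := star (U t)
  have hAU : 1 + A = U t := add_sub_cancel _ _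
  have hV : V * (1 + A) = 1 := by rw [hAU]; exact (Unitary.mem_iff.1 hUt.1).1
  have hV' : (1 + A) * V = 1 := by rw [hAU]; exact (Unitary.mem_iff.1 hUt.1).2
  have hVA : Commute V A := by
    have h1 : Commute V (1 + A) := hV.trans hV'.symm
    simpa using h1.sub_right (Commute.one_right V)
  -- convergence of the path
  let C : ℝ → H →L[ℂ] H := fun s => ((s - t : ℝ) : ℂ)⁻¹ • (U s - U t)
  have hC : SchattenTendsto (m + 1) 1 C (𝓝[≠] t) B :=
    ⟨by rw [schattenQuotNorm_one]; exact hB.1, by simpa only [schattenQuotNorm_one] using hB.2⟩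
  have hAfin : schattenQuotNorm (m + 1) 1 A < ∞ := by rw [schattenQuotNorm_one]; exact hUt.2
  have hst : Tendsto (fun s : ℝ => ((s - t : ℝ) : ℂ) • (1 : H →L[ℂ] H)) (𝓝[≠] t) (𝓝 0) := by
    have h1 : Continuous fun s : ℝ => ((s - t : ℝ) : ℂ) • (1 : H →L[ℂ] H) := by fun_prop
    have h2 := h1.tendsto t
    simp only [sub_self, Complex.ofReal_zero, zero_smul] at h2
    exact h2.mono_left nhdsWithin_le_nhds
  have hX : SchattenTendsto (m + 1) 1 (fun s => U s - 1) (𝓝[≠] t) A := by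
    have h1 := (SchattenTendsto.tendsto_mul hp hst hC).add hp
      (SchattenTendsto.const (l := 𝓝[≠] t) hp hAfin)
    rw [zero_mul, zero_add] at h1
    refine h1.congr' ?_
    filter_upwards [self_mem_nhdsWithin] with s hs
    have hs' : ((s - t : ℝ) : ℂ) ≠ 0 := by exact_mod_cast sub_ne_zero.2 hs
    simp only [C, smul_one_mul, smul_smul, mul_inv_cancel₀ hs', one_smul, hA]
    abel
  have hUd : HasDerivAt (fun s => U s - 1) B t := by
    rw [hasDerivAt_iff_tendsto_slope]
    refine (hC.tendsto hp).congr fun s => ?_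
    simp only [C, slope_def_module, sub_sub_sub_cancel_right]
    rw [← Complex.ofReal_inv, Complex.coe_smul]
  have hgA := (hg A).hasFDerivAt
  set G := fderiv ℂ g A
  have hGd : HasDerivAt (fun s => g (U s - 1)) (G B) t :=
    HasFDerivAt.comp_hasDerivAt (l := g) (l' := G.restrictScalars ℝ) t (hgA.restrictScalars ℝ) hUd
  have hGs : Tendsto (fun s => ((s - t : ℝ) : ℂ)⁻¹ • (g (U s - 1) - g A)) (𝓝[≠] t) (𝓝 (G B)) := by
    refine (hasDerivAt_iff_tendsto_slope.1 hGd).congr fun s => ?_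
    simp only [slope_def_module]
    rw [← Complex.ofReal_inv, Complex.coe_smul]
  -- the derivative of the regularisation
  let D : (H →L[ℂ] H) → (H →L[ℂ] H) := fun Y => powDeriv A Y (m + 1) * g A + A ^ (m + 1) * G Y
  have hquot : SchattenTendsto (m + 1) (m + 1)
      (fun s => ((s - t : ℝ) : ℂ)⁻¹ • (F (U s - 1) - F A)) (𝓝[≠] t) (D B) := by
    refine (SchattenTendsto.powDeriv hp hX hC hGs (g A)).congr' (Eventually.of_forall fun s => ?_)
    have h1 : F (U s - 1) - F A = ((U s - 1) ^ (m + 1) - A ^ (m + 1)) * g A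
        + (U s - 1) ^ (m + 1) * (g (U s - 1) - g A) := by
      simp only [F]; noncomm_ring
    have h2 : U s - 1 - A = U s - U t := by rw [hA]; abel
    simp only [C, h1, pow_sub_pow_eq_sum, h2, smul_add, mul_smul_comm, smul_mul_assoc,
      ← Finset.smul_sum]
  obtain ⟨⟨d, hd⟩, e, he, hfe⟩ := hquot.exists_hasNuclearBound hp
  have hF : SchattenTendsto (m + 1) (m + 1) (fun _ : ℕ => F A) atTop (F A) :=
    ((SchattenTendsto.const hp hAfin).pow le_rfl).mul_tendsto le_rfl tendsto_const_nhds
  obtain ⟨⟨c, hc⟩, -⟩ := hF.exists_hasNuclearBound hp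
  have hF1 : schattenNorm 1 (F A) < ∞ := by rw [← schattenQuotNorm_self hp]; exact hF.1
  -- the inverse
  set Q := aeval A (logPoly m)
  set W := NormedSpace.exp (-Q) * V
  have h1F : 1 + F A = (1 + A) * NormedSpace.exp Q := by
    simp only [F]; rw [← hfg A]; abel
  have hW : (1 + F A) * W = 1 := by
    rw [h1F]; simp only [W]
    rw [mul_assoc, ← mul_assoc (NormedSpace.exp Q), exp_mul_exp_neg, one_mul, hV']
  -- `1 - W F(A)` is a right inverse of `1 + F(A)` and a nuclear perturbation of the identity, so
  -- the two determinants multiply to `1`.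
  have hne : fredholmDet (F A) ≠ 0 := by
    have h1 := hc.fredholmDet_mul (hc.mul_left W).neg
    have h3 : F A + -(W * F A) + F A * -(W * F A) = 0 := by
      have : F A + -(W * F A) + F A * -(W * F A) = F A - (1 + F A) * W * F A := by noncomm_ring
      rw [this, hW, one_mul, sub_self]
    rw [h3, fredholmDet_zero] at h1
    exact left_ne_zero_of_mul (h1 ▸ one_ne_zero)
  -- the trace
  have hDF : HasFDerivAt (fun A : H →L[ℂ] H =>
      (1 + A) * NormedSpace.exp (aeval A (logPoly m)) - 1) (fderiv ℂ F A) A := by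
    simp only [hfg]
    have : Differentiable ℂ F := (differentiable_id.pow (m + 1)).mul hg
    exact (this A).hasFDerivAt
  have hDF' : ∀ Y, fderiv ℂ F A Y = D Y := fun Y => by
    obtain ⟨P, hP, hPY⟩ := exists_hasFDerivAt_pow A (m + 1)
    rw [show fderiv ℂ F A = _ from (hP.mul' hgA).fderiv]
    simp [D, hPY, add_comm]
  -- The identity is known for the finite-rank directions `B P_N`, and both sides pass to the limit.
  have hBN := schattenTendsto_mul_basisProj hp hB.1 h₀
  have hlim₁ : Tendsto (fun N => trace (W * D (B * basisProj h₀ N))) atTop (𝓝 (trace (W * D B))) := by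
    refine tendsto_trace hp (SchattenTendsto.tendsto_mul le_rfl tendsto_const_nhds ?_)
    exact SchattenTendsto.powDeriv hp (SchattenTendsto.const hp hAfin) hBN
      ((G.continuous.tendsto B).comp (hBN.tendsto hp)) (g A)
  have hword : ∀ {Y : ℕ → H →L[ℂ] H}, SchattenTendsto (m + 1) 1 Y atTop B →
      SchattenTendsto (m + 1) (m + 1) (fun N => V * Y N * A ^ m) atTop (V * B * A ^ m) := fun hY => by
    have := (SchattenTendsto.tendsto_mul hp (tendsto_const_nhds (x := V)) hY).mul_pow
      (SchattenTendsto.const hp hAfin) (j := m) (by omega)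
    rwa [add_comm 1 m] at this
  have hlim₂ := (tendsto_trace hp (hword hBN)).const_mul ((-1 : ℂ) ^ m)
  have heq : ∀ N, trace (W * D (B * basisProj h₀ N)) =
      (-1) ^ m * trace (V * (B * basisProj h₀ N) * A ^ m) := fun N => by
    have hPN : ∃ b, HasNuclearBound (basisProj h₀ N) b :=
      ⟨_, HasNuclearBound.sum (Finset.range N) fun k _ =>
        HasNuclearBound.rankOne (h₀ k) (h₀ k) fun v => by simp⟩
    obtain ⟨b, hb⟩ := hPN
    rw [← hDF']
    exact (trace_deriv_of_nuclear (hb.mul_left B) hV hVA hDF).2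
  have htr : trace (W * D B) = (-1) ^ m * trace (V * B * A ^ m) := by
    simp only [heq] at hlim₁
    exact tendsto_nhds_unique hlim₁ hlim₂
  refine ⟨?_, ?_, ?_, ?_⟩
  · rw [hreg]; exact hF1
  · rw [regDet, hreg]; exact hne
  · have := (hword (SchattenTendsto.const hp hC.1)).1
    rwa [schattenQuotNorm_self hp] at this
  · have := hasDerivAt_fredholmDet (f := fun s => F (U s - 1)) hc hd he hfe hW
    rw [htr] at this
    simpa only [regDet, hreg] using this

end RegDet

/-- Orthonormal vectors lie at distance `√2`, so the balls of radius `1 / 2` around them are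
disjoint and separability makes the basis countable. -/
theorem exists_hilbertBasis_nat [TopologicalSpace.SeparableSpace H] (hH : ¬ FiniteDimensional ℂ H) :
    Nonempty (HilbertBasis ℕ ℂ H) := by
  obtain ⟨w, b, -⟩ := exists_hilbertBasis ℂ H
  have hinf : Infinite w := by
    by_contra hfin
    rw [not_infinite_iff_finite] at hfin
    have := Fintype.ofFinite w
    exact hH b.toOrthonormalBasis.toBasis.finiteDimensional_of_finite
  have hcount : Countable w := by
    refine Pairwise.countable_of_isOpen_disjoint (s := fun i => Metric.ball (b i) (1 / 2))
      (fun i j hij => Metric.ball_disjoint_ball ?_) (fun _ => Metric.isOpen_ball)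
      fun i => Metric.nonempty_ball.2 (by norm_num)
    rw [dist_eq_norm]
    have h1 : ‖b i - b j‖ ^ 2 = 2 := by
      rw [norm_sub_sq (𝕜 := ℂ), b.orthonormal.inner_eq_zero hij, b.orthonormal.norm_eq_one,
        b.orthonormal.norm_eq_one]
      norm_num
    nlinarith [norm_nonneg (b i - b j)]
  obtain ⟨e⟩ : Nonempty (w ≃ ℕ) := nonempty_equiv_of_countable
  refine ⟨HilbertBasis.mk (v := b ∘ e.symm) (b.orthonormal.comp _ e.symm.injective) ?_⟩
  rw [Set.range_comp, e.symm.range_eq_univ, Set.image_univ, b.dense_span]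

end

end SchattenUnitaries

end

/-! ### The theorem. -/

open SchattenUnitaries in
theorem mainTheorem9 {H : Type*} [NormedAddCommGroup H] [InnerProductSpace ℂ H] [CompleteSpace H]
    [TopologicalSpace.SeparableSpace H] (hH : ¬ FiniteDimensional ℂ H)
    (p : ℕ) (hp : 1 ≤ p) (U U' : ℝ → H →L[ℂ] H)
    (hU : ∀ t ∈ Icc (0 : ℝ) 1, U t ∈ schattenUnitaries H (p : ℝ))
    (hU' : ∀ t ∈ Ioo (0 : ℝ) 1, HasSchattenDerivAt (p : ℝ) U (U' t) t) :
    ∀ᵐ t ∂(volume.restrict (Icc (0 : ℝ) 1)),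
      DifferentiableAt ℝ (fun s => regDet p (U s)) t ∧
      regularisation p (U t) ∈ schattenClass H 1 ∧
      regDet p (U t) ≠ 0 ∧
      star (U t) * U' t * (U t - 1) ^ (p - 1) ∈ schattenClass H 1 ∧
      deriv (fun s => regDet p (U s)) t / regDet p (U t) =
        (-1) ^ (p - 1) * trace (star (U t) * U' t * (U t - 1) ^ (p - 1)) := by
  have := exists_hilbertBasis_nat hH
  obtain ⟨m, rfl⟩ : ∃ m, p = m + 1 := ⟨p - 1, by omega⟩
  -- The exceptional null set consists only of the endpoints, where no derivative is assumed.
  rw [← restrict_Ioo_eq_restrict_Icc, ae_restrict_iff' measurableSet_Ioo]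
  refine Eventually.of_forall fun t ht => ?_
  obtain ⟨h1, h2, h3, h4⟩ := hasDerivAt_regDet (hU t (Ioo_subset_Icc_self ht)) (hU' t ht)
  refine ⟨h4.differentiableAt, h1, h2, h3, ?_⟩
  rw [h4.deriv, mul_div_cancel_left₀ _ h2, Nat.add_sub_cancel]
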